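/- Let $n=2j\ge 0$ be an integer and let $\varphi_j:SU(2)\to U(n+1)$ be the irreducible representation on $\mathbb{C}^{n+1}$ in the standard basis $u(j,j),u(j,j-1),\dots,u(j,-j)$, in which $J_3=\mathrm{diag}(j,j-1,\dots,-j)$ and $J_-=J_+^{T}$ has the subdiagonal entries $\sqrt{n\cdot 1},\sqrt{(n-1)\cdot 2},\dots,\sqrt{1\cdot n}$. For $P\in M_{\mathbb{C}}(n+1)$ and $g\in SU(2)$ put $P^g=\varphi_j(g)P\varphi_j(g)^{-1}$, and let $SU(2)$ act on $S^2$ by rotations through $SU(2)\to SO(3)$, with north pole $\mathbf{n}_0=(0,0,1)$ and surface element $dS$. A symbol correspondence is an injective linear map $P\mapsto W_P$ from $M_{\mathbb{C}}(n+1)$ to $C^\infty_{\mathbb{C}}(S^2)$ with $W_{P^g}(\mathbf{n})=W_P(g^{-1}\mathbf{n})$, $W_{P^*}=\overline{W_P}$ and $\frac1{4\pi}\int_{S^2}W_P\,dS=\frac1{n+1}\mathrm{trace}(P)$ for all $P$, $g$, $\mathbf{n}$. It is a Stratonovich–Weyl correspondence if moreover $\frac1{4\pi}\int_{S^2}\overline{W_P}\,W_Q\,dS=\frac1{n+1}\mathrm{trace}(P^*Q)$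 for all $P,Q$. For a diagonal matrix $K$ let $K(g\mathbf{n}_0)=K^g$, and let $W^K_P(\mathbf{n})=\mathrm{trace}(PK(\mathbf{n}))$ be its covariant symbol map. $K$ is an operator kernel if $W^K$ is a symbol correspondence. A contravariant symbol map given by $K$ is a map $\widetilde W$ from $M_{\mathbb{C}}(n+1)$ to the space of restrictions to $S^2$ of complex polynomials of degree at most $n$, such that for all $P$ $$P=\frac{n+1}{4\pi}\int_{S^2}\widetilde W_P(\mathbf{n})\,K(\mathbf{n})\,dS. \qquad (1)$$ For non-zero real numbers $c=(c_1,\dots,c_n)$ let $$K_c=\frac{1}{n+1}I+\sum_{l=1}^n c_l\sqrt{\tfrac{2l+1}{n+1}}\;\mathbf{e}^j(l,0),\qquad \mathbf{e}^j(l,0)=\frac{(-1)^l}{l!}\sqrt{2l+1}\sqrt{\tfrac{(n-l)!}{(n+l+1)!}}\sum_{k=0}^l(-1)^k\binom lk J_-^{\,l-k}J_+^{\,l}J_-^{\,k},$$ the diagonal matrix with characteristic numbers $c_1,\dots,c_n$. Then: (a) For all non-zero real $c_1,\dots,c_n$ the matrix $K_c$ is an operator kernel, and the covariant symbol correspondence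 $W^{K_c}$ is the unique contravariant symbol map given by $K_{\tilde c}$, where $\tilde c_l=1/c_l$ for $l=1,\dots,n$. In other words, a map $\widetilde W$ from $M_{\mathbb{C}}(n+1)$ to the polynomial functions of degree at most $n$ on $S^2$ satisfies (1) with $K=K_{\tilde c}$ if and only if $\widetilde W=W^{K_c}$. Moreover, for non-zero real $c'_1,\dots,c'_n$, the map $W^{K_c}$ is a contravariant symbol map given by $K_{c'}$ if and only if $c'_l=1/c_l$ for all $l$. (b) A symbol correspondence $W$ is a Stratonovich–Weyl correspondence if and only if it is self-dual, that is, there is an operator kernel $K$ such that $W$ is both the covariant symbol correspondence $W^K$ and a contravariant symbol map given by the same $K$. -/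

import Mathlib

open MeasureTheory
open scoped Manifold ContDiff

noncomputable section

namespace SpinJ

/-! ### The groups and spaces -/

/-- The group `SU(2)`. -/
abbrev SU2 : Type := Matrix.specialUnitaryGroup (Fin 2) ℂ

/-- Euclidean 3-space. -/
abbrev E3 : Type := EuclideanSpace ℝ (Fin 3)

/-- The unit sphere `S² ⊂ ℝ³`. -/
abbrev S2 : Type := Metric.sphere (0 : E3) 1

/-- The surface measure `dS` of `S²` (of total mass `4π`). -/
def surface : Measure S2 := (volume : Measure E3).toSphere

/-- Operators on the spin-`j` space `ℂ^(n+1)`, `n = 2j`, as matrices in the standard basis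
`u(j, j), u(j, j - 1), …, u(j, -j)`; the index `q : Fin (n + 1)` stands for `u(j, j - q)`. -/
abbrev Op (n : ℕ) : Type := Matrix (Fin (n + 1)) (Fin (n + 1)) ℂ

/-! ### The covering `SU(2) → SO(3)`, acting on the sphere -/

/-- `v · σ = v₁ σ₁ + v₂ σ₂ + v₃ σ₃` with the Pauli matrices `σ₁, σ₂, σ₃`. -/
def pauli (v : E3) : Matrix (Fin 2) (Fin 2) ℂ :=
  !![(v 2 : ℂ), (v 0 : ℂ) - Complex.I * (v 1 : ℂ);
     (v 0 : ℂ) + Complex.I * (v 1 : ℂ), -(v 2 : ℂ)]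

/-- The matrix `g (v · σ) g⁻¹`. -/
def pauliConj (g : SU2) (v : E3) : Matrix (Fin 2) (Fin 2) ℂ :=
  (g : Matrix (Fin 2) (Fin 2) ℂ) * pauli v * ((g⁻¹ : SU2) : Matrix (Fin 2) (Fin 2) ℂ)

/-- The rotation `R` of `ℝ³` covered by `g ∈ SU(2)`: `g (v · σ) g⁻¹ = (R v) · σ`
(see `pauli_rot`). -/
def rot (g : SU2) (v : E3) : E3 :=
  !₂[(pauliConj g v 1 0).re, (pauliConj g v 1 0).im, (pauliConj g v 0 0).re]

theorem SU2.mul_inv_coe (g : SU2) :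
    (g : Matrix (Fin 2) (Fin 2) ℂ) * ((g⁻¹ : SU2) : Matrix (Fin 2) (Fin 2) ℂ) = 1 :=
  congrArg Subtype.val (mul_inv_cancel g)

theorem SU2.inv_mul_coe (g : SU2) :
    ((g⁻¹ : SU2) : Matrix (Fin 2) (Fin 2) ℂ) * (g : Matrix (Fin 2) (Fin 2) ℂ) = 1 :=
  congrArg Subtype.val (inv_mul_cancel g)

theorem SU2.inv_coe (g : SU2) :
    ((g⁻¹ : SU2) : Matrix (Fin 2) (Fin 2) ℂ) =
      (g : Matrix (Fin 2) (Fin 2) ℂ).conjTranspose := rfl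

theorem pauli_conjTranspose (v : E3) : (pauli v).conjTranspose = pauli v := by
  ext i j
  fin_cases i <;> fin_cases j <;> simp [pauli, Matrix.conjTranspose_apply, sub_eq_add_neg]

theorem pauliConj_conjTranspose (g : SU2) (v : E3) :
    (pauliConj g v).conjTranspose = pauliConj g v := by
  simp [pauliConj, SU2.inv_coe, Matrix.conjTranspose_mul, pauli_conjTranspose, Matrix.mul_assoc]

theorem pauliConj_trace (g : SU2) (v : E3) : (pauliConj g v).trace = 0 := by
  rw [pauliConj, Matrix.trace_mul_comm, ← Matrix.mul_assoc, SU2.inv_mul_coe, Matrix.one_mul]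
  simp [pauli, Matrix.trace_fin_two]

theorem pauliConj_det (g : SU2) (v : E3) : (pauliConj g v).det = (pauli v).det := by
  have h := congrArg Matrix.det (SU2.mul_inv_coe g)
  rw [Matrix.det_mul, Matrix.det_one] at h
  rw [pauliConj, Matrix.det_mul, Matrix.det_mul]
  linear_combination (pauli v).det * h

theorem pauli_rot (g : SU2) (v : E3) : pauli (rot g v) = pauliConj g v := by
  have hh := pauliConj_conjTranspose g v
  have ht := pauliConj_trace g v
  have h00 : (starRingEnd ℂ) (pauliConj g v 0 0) = pauliConj g v 0 0 := congrFun (congrFun hh 0) 0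
  have h01 : (starRingEnd ℂ) (pauliConj g v 1 0) = pauliConj g v 0 1 := congrFun (congrFun hh 0) 1
  rw [Matrix.trace_fin_two] at ht
  have hr : ((pauliConj g v 0 0).re : ℂ) = pauliConj g v 0 0 := Complex.conj_eq_iff_re.mp h00
  have h11 : pauliConj g v 1 1 = -pauliConj g v 0 0 := by linear_combination ht
  ext i j
  fin_cases i <;> fin_cases j
  · simpa [pauli, rot] using hr
  · simp only [pauli, rot]
    rw [show (pauliConj g v) ⟨0, by simp⟩ ⟨1, by simp⟩ = pauliConj g v 0 1 from rfl, ← h01]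
    apply Complex.ext <;> simp
  · simp only [pauli, rot]
    apply Complex.ext <;> simp
  · simp only [pauli, rot]
    rw [show (pauliConj g v) ⟨1, by simp⟩ ⟨1, by simp⟩ = pauliConj g v 1 1 from rfl, h11, ← hr]
    simp

theorem pauli_det (v : E3) : (pauli v).det = -((‖v‖ ^ 2 : ℝ) : ℂ) := by
  rw [EuclideanSpace.norm_sq_eq, Fin.sum_univ_three]
  simp only [pauli, Matrix.det_fin_two_of, Real.norm_eq_abs, sq_abs]
  push_cast
  linear_combination (v 1 : ℂ) ^ 2 * Complex.I_sq

theorem norm_rot (g : SU2) (v : E3) : ‖rot g v‖ = ‖v‖ := by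
  have h := pauli_det (rot g v)
  rw [pauli_rot, pauliConj_det, pauli_det, neg_inj, Complex.ofReal_inj] at h
  exact ((sq_eq_sq₀ (norm_nonneg _) (norm_nonneg _)).mp h).symm

/-- The action of `SU(2)` on `S²` by rotations. -/
def rotS (g : SU2) (x : S2) : S2 :=
  ⟨rot g x, by rw [mem_sphere_zero_iff_norm, norm_rot]; exact norm_eq_of_mem_sphere x⟩

/-- The north pole `n₀ = (0, 0, 1)`. -/
def northPole : S2 :=
  ⟨!₂[0, 0, 1], by simp [EuclideanSpace.norm_eq, Fin.sum_univ_three]⟩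

theorem pauli_injective : Function.Injective pauli := by
  intro v w h
  have h0 := congrFun (congrFun h 0) 0
  have h1 := congrFun (congrFun h 1) 0
  simp only [pauli, Matrix.of_apply, Matrix.cons_val_zero, Matrix.cons_val_one,
    Complex.ofReal_inj] at h0 h1
  have hre := congrArg Complex.re h1
  have him := congrArg Complex.im h1
  simp at hre him
  ext i
  fin_cases i
  · exact hre
  · exact him
  · exact h0

/-- The matrix with rows `(a, -c̄)` and `(c, ā)`, where `|a|² + |c|² = 1`, as an element
of `SU(2)`. -/
def SU2.mk' (a c : ℂ) (h : a * (starRingEnd ℂ) a + c * (starRingEnd ℂ) c = 1) : SU2 :=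
  ⟨!![a, -(starRingEnd ℂ) c; c, (starRingEnd ℂ) a], by
    rw [Matrix.mem_specialUnitaryGroup_iff, Matrix.mem_unitaryGroup_iff]
    constructor
    · ext i j
      fin_cases i <;> fin_cases j <;>
        simp [Matrix.mul_apply, Fin.sum_univ_two, Matrix.star_apply]
      · linear_combination h
      · ring
      · ring
      · linear_combination h
    · rw [Matrix.det_fin_two_of]
      linear_combination h⟩

theorem exists_rotS_eq (x : S2) : ∃ g : SU2, rotS g northPole = x := by
  obtain ⟨v, hv⟩ := x
  have hn : v 0 ^ 2 + v 1 ^ 2 + v 2 ^ 2 = 1 := by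
    have h1 : ‖v‖ ^ 2 = 1 := by rw [mem_sphere_zero_iff_norm.mp hv]; norm_num
    simpa [EuclideanSpace.norm_sq_eq, Fin.sum_univ_three] using h1
  suffices h : ∃ g : SU2, pauliConj g (northPole : E3) = pauli v by
    obtain ⟨g, hg⟩ := h
    refine ⟨g, Subtype.ext (pauli_injective ?_)⟩
    rw [← hg, ← pauli_rot]
    rfl
  by_cases hz : v 2 = -1
  · have h0 : v 0 = 0 := by nlinarith [sq_nonneg (v 0), sq_nonneg (v 1)]
    have h1 : v 1 = 0 := by nlinarith [sq_nonneg (v 0), sq_nonneg (v 1)]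
    refine ⟨SU2.mk' 0 1 (by simp), ?_⟩
    rw [pauliConj, SU2.inv_coe]
    ext i j
    fin_cases i <;> fin_cases j <;>
      simp [SU2.mk', pauli, northPole, h0, h1, hz, Matrix.mul_apply, Fin.sum_univ_two,
        Matrix.conjTranspose_apply]
  · have hpos : 0 < 1 + v 2 := by
      have : -1 ≤ v 2 := by nlinarith [sq_nonneg (v 0), sq_nonneg (v 1)]
      rcases this.lt_or_eq with h | h
      · linarith
      · exact absurd h.symm hz
    set a : ℝ := Real.sqrt ((1 + v 2) / 2) with ha
    have ha2 : a ^ 2 = (1 + v 2) / 2 := Real.sq_sqrt (by linarith)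
    have ha0 : a ≠ 0 := by
      intro h
      rw [h] at ha2
      nlinarith
    set p : ℝ := v 0 / (2 * a) with hp
    set q : ℝ := v 1 / (2 * a) with hq
    have hpa : 2 * a * p = v 0 := by rw [hp]; field_simp
    have hqa : 2 * a * q = v 1 := by rw [hq]; field_simp
    have hpq : p ^ 2 + q ^ 2 = (1 - v 2) / 2 := by
      have h4 : 4 * a ^ 2 * (p ^ 2 + q ^ 2) = 1 - v 2 ^ 2 := by
        have : 4 * a ^ 2 * (p ^ 2 + q ^ 2) = (2 * a * p) ^ 2 + (2 * a * q) ^ 2 := by ring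
        rw [this, hpa, hqa]
        linarith
      rw [ha2] at h4
      have h5 : (1 + v 2) * (2 * (p ^ 2 + q ^ 2) - (1 - v 2)) = 0 := by nlinarith
      rcases mul_eq_zero.mp h5 with h | h
      · linarith
      · linarith
    have ha2c : (a : ℂ) ^ 2 = (1 + (v 2 : ℂ)) / 2 := by
      rw [← Complex.ofReal_pow, ha2]; push_cast; ring
    have hpqc : (p : ℂ) ^ 2 + (q : ℂ) ^ 2 = (1 - (v 2 : ℂ)) / 2 := by
      rw [← Complex.ofReal_pow, ← Complex.ofReal_pow, ← Complex.ofReal_add, hpq]; push_cast; ring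
    have hpac : 2 * (a : ℂ) * p = v 0 := by exact_mod_cast hpa
    have hqac : 2 * (a : ℂ) * q = v 1 := by exact_mod_cast hqa
    refine ⟨SU2.mk' a (p + Complex.I * q) ?_, ?_⟩
    · simp only [Complex.conj_ofReal, map_add, map_mul, Complex.conj_I]
      linear_combination ha2c + hpqc - (q : ℂ) ^ 2 * Complex.I_sq
    · rw [pauliConj, SU2.inv_coe]
      ext i j
      fin_cases i <;> fin_cases j <;>
        simp [SU2.mk', pauli, northPole, Matrix.mul_apply, Fin.sum_univ_two,
          Matrix.conjTranspose_apply]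
      · linear_combination ha2c - hpqc + (q : ℂ) ^ 2 * Complex.I_sq
      · linear_combination hpac - Complex.I * hqac
      · linear_combination hpac + Complex.I * hqac
      · linear_combination hpqc - ha2c - (q : ℂ) ^ 2 * Complex.I_sq

/-! ### The irreducible representation of spin `j = n / 2` in the standard basis -/

/-- For `g` with rows `(a, b)` and `(c, d)`, the dehomogenization in `X = z₂ / z₁` of the image
`(a z₁ + c z₂)^(n-q) (b z₁ + d z₂)^q` of the monomial `z₁^(n-q) z₂^q` under `g`. -/
def colPoly (n : ℕ) (g : Matrix (Fin 2) (Fin 2) ℂ) (q : ℕ) : Polynomial ℂ :=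
  (Polynomial.C (g 0 0) + Polynomial.C (g 1 0) * Polynomial.X) ^ (n - q) *
    (Polynomial.C (g 0 1) + Polynomial.C (g 1 1) * Polynomial.X) ^ q

/-- The norm `√((n-q)! q!)` of the monomial `z₁^(n-q) z₂^q`. -/
def monoNorm (n q : ℕ) : ℝ := Real.sqrt (((n - q).factorial * q.factorial : ℕ) : ℝ)

/-- The matrix of `g` acting on homogeneous polynomials of degree `n` in `(z₁, z₂)`, with respect
to the orthonormal basis `z₁^(n-q) z₂^q / √((n-q)! q!)`, `q = 0, …, n`, which is the standard
basis `u(j, j - q)` of spin `j = n / 2`. -/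
def spinMatrix (n : ℕ) (g : Matrix (Fin 2) (Fin 2) ℂ) : Op n :=
  Matrix.of fun r q =>
    ((monoNorm n r / monoNorm n q : ℝ) : ℂ) * (colPoly n g q).coeff r

theorem monoNorm_ne_zero (n q : ℕ) : monoNorm n q ≠ 0 := by
  have : 0 < (n - q).factorial * q.factorial := by positivity
  exact (Real.sqrt_pos.mpr (by exact_mod_cast this)).ne'

theorem natDegree_lin_pow (a b : ℂ) (k : ℕ) :
    ((Polynomial.C a + Polynomial.C b * Polynomial.X) ^ k).natDegree ≤ k := by
  refine Polynomial.natDegree_pow_le.trans ?_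
  have : (Polynomial.C a + Polynomial.C b * Polynomial.X).natDegree ≤ 1 := by compute_degree
  nlinarith

theorem homogenize_lin_pow (a b : ℂ) (k : ℕ) :
    ((Polynomial.C a + Polynomial.C b * Polynomial.X) ^ k).homogenize k =
      (MvPolynomial.C a * MvPolynomial.X 1 + MvPolynomial.C b * MvPolynomial.X 0) ^ k := by
  induction k with
  | zero => simp
  | succ k ih =>
    have h1 : (Polynomial.C a + Polynomial.C b * Polynomial.X).natDegree ≤ 1 := by compute_degree
    rw [pow_succ, Polynomial.homogenize_mul _ _ (natDegree_lin_pow a b k) h1, ih, pow_succ]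
    simp [Polynomial.homogenize_C_mul]

theorem colPoly_natDegree (n : ℕ) (g : Matrix (Fin 2) (Fin 2) ℂ) {q : ℕ} (hq : q ≤ n) :
    (colPoly n g q).natDegree ≤ n := by
  refine Polynomial.natDegree_mul_le.trans ?_
  have h1 := natDegree_lin_pow (g 0 0) (g 1 0) (n - q)
  have h2 := natDegree_lin_pow (g 0 1) (g 1 1) q
  omega

theorem colPoly_mul (n : ℕ) (g h : Matrix (Fin 2) (Fin 2) ℂ) {q : ℕ} (hq : q ≤ n) :
    colPoly n (g * h) q =
      ∑ r : Fin (n + 1), Polynomial.C ((colPoly n h q).coeff r) * colPoly n g r := by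
  set A := Polynomial.C (g 0 0) + Polynomial.C (g 1 0) * Polynomial.X with hA
  set B := Polynomial.C (g 0 1) + Polynomial.C (g 1 1) * Polynomial.X with hB
  have e1 : MvPolynomial.aeval ![B, A] ((colPoly n h q).homogenize n) = colPoly n (g * h) q := by
    have hn : n = (n - q) + q := by omega
    have : (colPoly n h q).homogenize n =
        ((Polynomial.C (h 0 0) + Polynomial.C (h 1 0) * Polynomial.X) ^ (n - q)).homogenize (n - q)
        * ((Polynomial.C (h 0 1) + Polynomial.C (h 1 1) * Polynomial.X) ^ q).homogenize q := by
      rw [← Polynomial.homogenize_mul _ _ (natDegree_lin_pow _ _ _) (natDegree_lin_pow _ _ _),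
        ← hn]
      rfl
    rw [this, homogenize_lin_pow, homogenize_lin_pow, colPoly]
    simp only [map_mul, map_pow, map_add, MvPolynomial.aeval_X, MvPolynomial.algHom_C,
      Polynomial.algebraMap_eq, Matrix.cons_val_zero, Matrix.cons_val_one, Matrix.mul_apply,
      Fin.sum_univ_two]
    rw [hA, hB]
    congr 2 <;> ring
  rw [← e1, Polynomial.homogenize, map_sum, Finset.Nat.sum_antidiagonal_eq_sum_range_succ_mk,
    Finset.sum_range]
  refine Finset.sum_congr rfl fun r _ => ?_
  rw [MvPolynomial.aeval_monomial]
  rw [show colPoly n g r = A ^ (n - (r : ℕ)) * B ^ (r : ℕ) from rfl]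
  simp [Finsupp.prod_fintype, Finsupp.update_apply, -mul_eq_mul_left_iff]
  ring

theorem spinMatrix_mul (n : ℕ) (g h : Matrix (Fin 2) (Fin 2) ℂ) :
    spinMatrix n (g * h) = spinMatrix n g * spinMatrix n h := by
  ext s q
  rw [Matrix.mul_apply]
  simp only [spinMatrix, Matrix.of_apply]
  rw [colPoly_mul n g h (Nat.lt_succ_iff.mp q.2), Polynomial.finsetSum_coeff, Finset.mul_sum]
  refine Finset.sum_congr rfl fun r _ => ?_
  rw [Polynomial.coeff_C_mul]
  have hr : ((monoNorm n r : ℝ) : ℂ) ≠ 0 := by exact_mod_cast monoNorm_ne_zero n r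
  have hq : ((monoNorm n q : ℝ) : ℂ) ≠ 0 := by exact_mod_cast monoNorm_ne_zero n q
  push_cast
  field_simp

theorem spinMatrix_apply_of_diag (n : ℕ) (g : Matrix (Fin 2) (Fin 2) ℂ) (h01 : g 0 1 = 0)
    (h10 : g 1 0 = 0) {r q : Fin (n + 1)} (hrq : r ≠ q) : spinMatrix n g r q = 0 := by
  have hv : (r : ℕ) ≠ (q : ℕ) := fun h => hrq (Fin.ext h)
  simp only [spinMatrix, Matrix.of_apply, colPoly, h01, h10, map_zero, zero_mul, add_zero,
    zero_add, mul_pow, ← Polynomial.C_pow]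
  rw [Polynomial.coeff_C_mul, Polynomial.coeff_C_mul, Polynomial.coeff_X_pow, if_neg hv]
  simp

theorem spinMatrix_one (n : ℕ) : spinMatrix n 1 = 1 := by
  ext r q
  by_cases hrq : r = q
  · subst hrq
    have hr : ((monoNorm n r : ℝ) : ℂ) ≠ 0 := by exact_mod_cast monoNorm_ne_zero n r
    simp [spinMatrix, colPoly, hr]
  · rw [spinMatrix_apply_of_diag n 1 (by simp) (by simp) hrq, Matrix.one_apply_ne hrq]

/-- The irreducible representation `φ_j` of `SU(2)` on `ℂ^(n+1)`, `n = 2j`, in the standard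
basis. -/
def spinRep (n : ℕ) : SU2 →* Op n where
  toFun g := spinMatrix n g
  map_one' := spinMatrix_one n
  map_mul' g h := spinMatrix_mul n g h

/-- The action `P ↦ P^g = φ_j(g) P φ_j(g)⁻¹` of `SU(2)` on operators. -/
def actOp (n : ℕ) (g : SU2) (P : Op n) : Op n :=
  spinRep n g * P * spinRep n g⁻¹

/-! ### Symbol correspondences -/

/-- `F` is the restriction to `S²` of a complex polynomial of degree at most `n`. -/
def IsPolyOfDegreeLE (n : ℕ) (F : S2 → ℂ) : Prop :=
  ∃ p : MvPolynomial (Fin 3) ℂ, p.totalDegree ≤ n ∧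
    ∀ x : S2, F x = MvPolynomial.eval (fun i => (((x : E3) i : ℝ) : ℂ)) p

/-- Symbol correspondences for a spin-`j` system, `n = 2j`. -/
structure IsSymbolCorrespondence (n : ℕ) (W : Op n → S2 → ℂ) : Prop where
  smooth : ∀ P, ContMDiff (𝓡 2) 𝓘(ℝ, ℂ) ∞ (W P)
  linear : IsLinearMap ℂ W
  injective : Function.Injective W
  equivariant : ∀ (g : SU2) (P : Op n) (x : S2), W (actOp n g P) x = W P (rotS g⁻¹ x)
  real : ∀ (P : Op n) (x : S2), W P.conjTranspose x = (starRingEnd ℂ) (W P x)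
  normalized : ∀ P : Op n,
    1 / (4 * (Real.pi : ℂ)) * ∫ x, W P x ∂surface = 1 / ((n : ℂ) + 1) * P.trace

/-- Stratonovich–Weyl correspondences: isometric symbol correspondences. -/
structure IsStratonovichWeyl (n : ℕ) (W : Op n → S2 → ℂ) : Prop
    extends IsSymbolCorrespondence n W where
  isometry : ∀ P Q : Op n,
    1 / (4 * (Real.pi : ℂ)) * ∫ x, (starRingEnd ℂ) (W P x) * W Q x ∂surface =
      1 / ((n : ℂ) + 1) * (P.conjTranspose * Q).trace

/-! ### Operator kernels -/

/-- The operator-valued function `K(𝐧) = K^g`, `𝐧 = g 𝐧₀`, of a diagonal matrix `K`;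
by `kernelAt_rotS` it does not depend on the choice of `g`. -/
def kernelAt (n : ℕ) (K : Op n) (x : S2) : Op n :=
  actOp n (Classical.choose (exists_rotS_eq x)) K

theorem actOp_eq_of_rotS_eq (n : ℕ) {K : Op n} (hK : K.IsDiag) {g h : SU2}
    (hgh : rotS g northPole = rotS h northPole) : actOp n g K = actOp n h K := by
  have hp : pauliConj g (northPole : E3) = pauliConj h (northPole : E3) := by
    rw [← pauli_rot, ← pauli_rot]
    exact congrArg (fun y : S2 => pauli y) hgh
  obtain ⟨u, rfl⟩ : ∃ u : SU2, h = g * u := ⟨g⁻¹ * h, by group⟩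
  have hu : (u : Matrix (Fin 2) (Fin 2) ℂ) * pauli northPole =
      pauli northPole * (u : Matrix (Fin 2) (Fin 2) ℂ) := by
    have h1 := congrArg (fun M => ((g⁻¹ : SU2) : Matrix (Fin 2) (Fin 2) ℂ) * M *
      ((g * u : SU2) : Matrix (Fin 2) (Fin 2) ℂ)) hp
    simp only [pauliConj, Submonoid.coe_mul, mul_inv_rev, Matrix.mul_assoc] at h1
    rw [← Matrix.mul_assoc _ _ (u : Matrix (Fin 2) (Fin 2) ℂ), SU2.inv_mul_coe,
      ← Matrix.mul_assoc _ (g : Matrix (Fin 2) (Fin 2) ℂ) _, SU2.inv_mul_coe,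
      ← Matrix.mul_assoc _ (g : Matrix (Fin 2) (Fin 2) ℂ) _, SU2.inv_mul_coe] at h1
    simp only [Matrix.one_mul, SU2.inv_mul_coe, Matrix.mul_one] at h1
    exact h1.symm
  have h01 : (u : Matrix (Fin 2) (Fin 2) ℂ) 0 1 = 0 := by
    have := congrFun (congrFun hu 0) 1
    simp [pauli, northPole, Matrix.mul_apply, Fin.sum_univ_two] at this
    linear_combination -(1 / 2) * this
  have h10 : (u : Matrix (Fin 2) (Fin 2) ℂ) 1 0 = 0 := by
    have := congrFun (congrFun hu 1) 0
    simp [pauli, northPole, Matrix.mul_apply, Fin.sum_univ_two] at this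
    linear_combination (1 / 2) * this
  have hd : (spinRep n u).IsDiag := fun r q hrq =>
    spinMatrix_apply_of_diag n _ h01 h10 hrq
  have hc : spinRep n u * K = K * spinRep n u := by
    rw [← hd.diagonal_diag, ← hK.diagonal_diag, Matrix.diagonal_mul_diagonal,
      Matrix.diagonal_mul_diagonal]
    simp only [mul_comm]
  have hi : spinRep n u * spinRep n u⁻¹ = 1 := by rw [← map_mul, mul_inv_cancel, map_one]
  rw [actOp, actOp, mul_inv_rev, map_mul, map_mul, mul_assoc (spinRep n g) (spinRep n u) K, hc,
    ← mul_assoc, ← mul_assoc, mul_assoc (spinRep n g * K), hi, mul_one]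

theorem kernelAt_rotS (n : ℕ) {K : Op n} (hK : K.IsDiag) (g : SU2) :
    kernelAt n K (rotS g northPole) = actOp n g K :=
  actOp_eq_of_rotS_eq n hK (Classical.choose_spec (exists_rotS_eq (rotS g northPole)))

/-- The covariant symbol map `W^K` of a diagonal matrix `K`:
`W_P(𝐧) = trace (P K(𝐧))`. -/
def covariantSymbol (n : ℕ) (K : Op n) (P : Op n) (x : S2) : ℂ :=
  (P * kernelAt n K x).trace

/-- Operator kernels: diagonal matrices whose covariant symbol map is a symbol
correspondence. -/
def IsOperatorKernel (n : ℕ) (K : Op n) : Prop :=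
  K.IsDiag ∧ IsSymbolCorrespondence n (covariantSymbol n K)

/-- `∫_{S²} F(𝐧) K(𝐧) dS`, computed entrywise. -/
def kernelIntegral (n : ℕ) (K : Op n) (F : S2 → ℂ) : Op n :=
  Matrix.of fun r q => ∫ x, F x * kernelAt n K x r q ∂surface

/-- `W` is the contravariant symbol map given by `K`: it takes values in the polynomial functions
of degree `≤ n` and satisfies `P = (n+1)/(4π) ∫_{S²} W_P(𝐧) K(𝐧) dS` for every `P`. -/
structure IsContravariantSymbol (n : ℕ) (K : Op n) (W : Op n → S2 → ℂ) : Prop where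
  poly : ∀ P, IsPolyOfDegreeLE n (W P)
  integral_eq : ∀ P,
    P = (((n : ℂ) + 1) / (4 * (Real.pi : ℂ))) • kernelIntegral n K (W P)

/-- A symbol correspondence is self-dual if the contravariant correspondence given by its
operator kernel is the correspondence itself. -/
def IsSelfDual (n : ℕ) (W : Op n → S2 → ℂ) : Prop :=
  ∃ K : Op n, IsOperatorKernel n K ∧ covariantSymbol n K = W ∧ IsContravariantSymbol n K W

/-! ### Characteristic numbers -/

/-- The lowering operator `J₋`: `J₋ u(j, m) = √((j+m)(j-m+1)) u(j, m-1)`, `m = j - q`. -/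
def Jminus (n : ℕ) : Op n :=
  Matrix.of fun r q =>
    if (r : ℕ) = q + 1 then ((Real.sqrt (((n : ℝ) - q) * (q + 1)) : ℝ) : ℂ) else 0

/-- The raising operator `J₊`, the transpose of `J₋`. -/
def Jplus (n : ℕ) : Op n := (Jminus n).transpose

/-- The coupled standard basis vector `e^j(l, 0)`, for `l ≤ n = 2j`. -/
def coupledZero (n l : ℕ) : Op n :=
  (((-1) ^ l / (l.factorial : ℝ) * Real.sqrt (2 * l + 1) *
      Real.sqrt (((n - l).factorial : ℝ) / ((n + l + 1).factorial : ℝ)) : ℝ) : ℂ) •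
    ∑ k ∈ Finset.range (l + 1),
      ((-1) ^ k * (l.choose k : ℂ)) • (Jminus n ^ (l - k) * Jplus n ^ l * Jminus n ^ k)

/-- The matrix `K = I/(n+1) + ∑_{l=1}^n c_l √((2l+1)/(n+1)) e^j(l, 0)` with characteristic
numbers `c_1, …, c_n`; the index `i : Fin n` stands for `l = i + 1`. -/
def charKernel (n : ℕ) (c : Fin n → ℝ) : Op n :=
  (1 / ((n : ℂ) + 1)) • (1 : Op n) +
    ∑ i : Fin n, ((c i * Real.sqrt ((2 * ((i : ℝ) + 1) + 1) / ((n : ℝ) + 1)) : ℝ) : ℂ) •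
      coupledZero n (i + 1)

end SpinJ

end

open SpinJ

/-! Under `SU(2)` the operator space is a multiplicity-free sum of blocks `l = 0, …, n`, block `l`
having the basis `ad(J₋)^k (J₊^l)` with `0 ≤ k ≤ 2l`. For diagonal `A`, `B` the map `P ↦ ∫ trace(P
A(𝐧)) B(𝐧) dS` (`pairMap`) commutes with the group, so by Schur's lemma (`exists_scalar_of_commute`)
it is a scalar on each block. Its trace is `4π trace(AB)` (`trace_pairMap`). If `A = e^j(l,0)`,
every scalar except the `l`-th vanishes, and the trace determines that one. Hence `A = K_c`, `B =
K_c̃` give the scalar `4π c_l c̃_l / (n+1)` on block `l` (with `c_0 = c̃_0 = 1`), and for `c̃ = 1/c`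
formula (1) becomes an identity: `charKernel_reconstruction`. Injectivity and normalization of
`W^{K_c}` follow from it.

Uniqueness is a dimension count. Polynomial functions of degree at most `n` on the sphere are
spanned by `(n+1)²` functions, so the injective map `W^{K_c}` reaches all of them
(`exists_symbol_eq`). Each value of a contravariant map is therefore `W^{K_c}_Q` for some `Q`, and
(1) forces `Q` to be the given operator; linearity of the contravariant map is not needed.

For (b), every symbol correspondence is `W^K` for a diagonal `K` representing the functional "value
at the north pole". Since `∫ conj(W_P) W_Q dS = trace(P* ∫ W_Q K dS)`, nondegeneracy of the trace
form turns the isometry condition into (1) with the same `K`.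

The infinitesimal action is obtained without differentiating the group: through a polynomial
identity (`lieRep_mul_spinMatrix`) and a single torus element that separates weights
(`map_lie_weightOp`). -/

noncomputable section
namespace SpinJ

open scoped Pointwise

attribute [local instance] LieRing.ofAssociativeRing

/-! ### The derived representation -/

/-- The representation of `gl(2)` derived from `spinMatrix`. -/
def lieRep (n : ℕ) : Matrix (Fin 2) (Fin 2) ℂ →ₗ[ℂ] Op n where
  toFun X := X 0 0 • Matrix.diagonal (fun q : Fin (n + 1) => (n : ℂ) - (q : ℕ)) +
    X 1 1 • Matrix.diagonal (fun q : Fin (n + 1) => ((q : ℕ) : ℂ)) +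
    X 1 0 • Jminus n + X 0 1 • Jplus n
  map_add' X Y := by simp only [Matrix.add_apply]; module
  map_smul' a X := by simp only [Matrix.smul_apply, smul_eq_mul, RingHom.id_apply]; module

/-- The entries of `lieRep n X` in the basis of unnormalized monomials. -/
def lieMon (n : ℕ) (X : Matrix (Fin 2) (Fin 2) ℂ) (r s : ℕ) : ℂ :=
  (if r = s then X 0 0 * ((n : ℂ) - s) + X 1 1 * s else 0) +
    (if r = s + 1 then X 1 0 * ((n : ℂ) - s) else 0) + (if s = r + 1 then X 0 1 * s else 0)

theorem monoNorm_pos (n q : ℕ) : 0 < monoNorm n q :=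
  lt_of_le_of_ne (Real.sqrt_nonneg _) (monoNorm_ne_zero n q).symm

theorem monoNorm_sq (n q : ℕ) :
    monoNorm n q ^ 2 = ((n - q).factorial : ℝ) * (q.factorial : ℝ) := by
  rw [monoNorm, Real.sq_sqrt (by positivity)]
  push_cast
  rfl

/-- Rescaling to unnormalized monomials trades the square root in `J₋` for the integer weight `n -
s`. -/
theorem sqrt_eq_monoNorm_div (n s : ℕ) (hs : s < n) :
    Real.sqrt (((n : ℝ) - s) * (s + 1)) = monoNorm n (s + 1) / monoNorm n s * ((n : ℝ) - s) := by
  have h1 : (s : ℝ) < n := by exact_mod_cast hs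
  have h2 : (0 : ℝ) < n - s := by linarith
  refine (Real.sqrt_eq_iff_mul_self_eq (by positivity)
    (by have := monoNorm_pos n s; have := monoNorm_pos n (s + 1); positivity)).mpr ?_
  have e : monoNorm n s ^ 2 * (s + 1) = monoNorm n (s + 1) ^ 2 * (n - s) := by
    rw [monoNorm_sq, monoNorm_sq]
    obtain ⟨m, rfl⟩ : ∃ m, n = s + m + 1 := ⟨n - s - 1, by omega⟩
    rw [show s + m + 1 - s = m + 1 by omega, show s + m + 1 - (s + 1) = m by omega,
      Nat.factorial_succ, Nat.factorial_succ]
    push_cast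
    ring
  have h3 := monoNorm_ne_zero n s
  field_simp
  linear_combination e

theorem lieRep_apply (n : ℕ) (X : Matrix (Fin 2) (Fin 2) ℂ) (r s : Fin (n + 1)) :
    lieRep n X r s = ((monoNorm n r / monoNorm n s : ℝ) : ℂ) * lieMon n X r s := by
  have hr := monoNorm_ne_zero n r
  have hs := monoNorm_ne_zero n s
  have hr' : ((monoNorm n r : ℝ) : ℂ) ≠ 0 := by exact_mod_cast hr
  have hs' : ((monoNorm n s : ℝ) : ℂ) ≠ 0 := by exact_mod_cast hs
  simp only [lieRep, LinearMap.coe_mk, AddHom.coe_mk, Matrix.add_apply, Matrix.smul_apply,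
    Jplus, Matrix.transpose_apply, Jminus, Matrix.of_apply, smul_eq_mul, lieMon]
  rw [mul_add ((monoNorm n r / monoNorm n s : ℝ) : ℂ), mul_add ((monoNorm n r / monoNorm n s : ℝ) : ℂ)]
  congr 1
  · congr 1
    · by_cases h : r = s
      · subst h
        simp [hr']
      · have h' : (r : ℕ) ≠ s := fun e => h (Fin.ext e)
        simp [h, h']
    · split_ifs with h
      · rw [sqrt_eq_monoNorm_div n s (by have := r.2; omega), h]
        push_cast
        ring
      · simp
  · split_ifs with h
    · have hlt : (r : ℕ) < n := by have := s.2; omega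
      have h1 : (r : ℝ) < n := by exact_mod_cast hlt
      have e := sqrt_eq_monoNorm_div n r hlt
      rw [← h] at e
      have e2 := Real.mul_self_sqrt (show (0 : ℝ) ≤ ((n : ℝ) - r) * (r + 1) by
        apply mul_nonneg <;> [linarith; positivity])
      have e3 : Real.sqrt (((n : ℝ) - r) * (r + 1)) = monoNorm n r / monoNorm n s * s := by
        have h0 : Real.sqrt (((n : ℝ) - r) * (r + 1)) ≠ 0 := by
          refine (Real.sqrt_pos.mpr (mul_pos (by linarith) (by positivity))).ne'
        apply mul_left_cancel₀ h0
        have hs2 := monoNorm_ne_zero n (r + 1)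
        rw [e2, e, h]
        push_cast
        field_simp
      rw [e3]
      push_cast
      ring
    · simp

/-- On dehomogenized polynomials in `x`, the four matrix units act as `n - x d/dx`, `x d/dx`, `n x -
x² d/dx` and `d/dx`. The degree bound removes the coefficient of index `n + 1` that the derivative
would need. -/
theorem sum_lieMon_mul_coeff (n : ℕ) (X : Matrix (Fin 2) (Fin 2) ℂ) (p : Polynomial ℂ)
    (hp : p.natDegree ≤ n) {r : ℕ} (hr : r ≤ n) :
    ∑ s : Fin (n + 1), lieMon n X r s * p.coeff s =
      (X 0 0 * ((n : ℂ) - r) + X 1 1 * r) * p.coeff r +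
      X 1 0 * (n * (Polynomial.X * p).coeff r -
        (Polynomial.X * (Polynomial.X * p.derivative)).coeff r) +
      X 0 1 * p.derivative.coeff r := by
  rw [Fin.sum_univ_eq_sum_range (fun s => lieMon n X r s * p.coeff s)]
  simp only [lieMon, add_mul, Finset.sum_add_distrib, ite_mul, zero_mul]
  congr 1
  · congr 1
    · rw [Finset.sum_ite_eq, if_pos (by simpa using Nat.lt_succ_of_le hr)]
    · cases r with
      | zero => simp
      | succ r =>
        simp only [add_left_inj]
        rw [Finset.sum_ite_eq, if_pos (by simp; omega), Polynomial.coeff_X_mul,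
          Polynomial.coeff_X_mul]
        cases r with
        | zero => simp [mul_assoc]
        | succ r =>
          rw [Polynomial.coeff_X_mul, Polynomial.coeff_derivative]
          push_cast
          ring
  · rw [Finset.sum_ite_eq', Polynomial.coeff_derivative]
    split_ifs with h
    · push_cast
      ring
    · rw [Polynomial.coeff_eq_zero_of_natDegree_lt (n := r + 1) (by simp at h; omega)]
      simp

/-- The values `F (n + 1)` and the truncated `F (0 - 1)` are harmless: their factors `n - q` and `q`
vanish at the ends. -/
theorem sum_mul_lieMon {R : Type*} [CommRing R] [Algebra ℂ R] (n : ℕ)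
    (X : Matrix (Fin 2) (Fin 2) ℂ) (F : ℕ → R) {q : ℕ} (hq : q ≤ n) :
    ∑ s : Fin (n + 1), lieMon n X s q • F s =
      (X 0 0 * ((n : ℂ) - q) + X 1 1 * q) • F q + (X 1 0 * ((n : ℂ) - q)) • F (q + 1) +
      (X 0 1 * q) • F (q - 1) := by
  rw [Fin.sum_univ_eq_sum_range (fun s => lieMon n X s q • F s)]
  simp only [lieMon, add_smul _ _ (F _), Finset.sum_add_distrib, ite_smul, zero_smul]
  congr 1
  · congr 1
    · rw [Finset.sum_ite_eq', if_pos (by simpa using Nat.lt_succ_of_le hq)]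
    · rw [Finset.sum_ite_eq']
      split_ifs with h
      · rfl
      · have : q = n := by simp at h; omega
        simp [this]
  · cases q with
    | zero => simp
    | succ q =>
      simp only [add_left_inj]
      rw [Finset.sum_ite_eq, if_pos (by simp; omega)]
      simp

-- By the Leibniz rule the operator of `Y` on a product of powers of the two linear forms of `g` is
-- determined by its effect on those forms; `Y g = g X` says that it mixes them through `X`.
open Polynomial in
theorem lie_colPoly (n : ℕ) (g X Y : Matrix (Fin 2) (Fin 2) ℂ) (h : Y * g = g * X) {q : ℕ}
    (hq : q ≤ n) :
    C (Y 0 0) * (C (n : ℂ) * colPoly n g q - Polynomial.X * derivative (colPoly n g q)) +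
      C (Y 1 1) * (Polynomial.X * derivative (colPoly n g q)) +
      C (Y 1 0) * (C (n : ℂ) * (Polynomial.X * colPoly n g q) -
        Polynomial.X * (Polynomial.X * derivative (colPoly n g q))) +
      C (Y 0 1) * derivative (colPoly n g q) =
    (X 0 0 * ((n : ℂ) - q) + X 1 1 * q) • colPoly n g q +
      (X 1 0 * ((n : ℂ) - q)) • colPoly n g (q + 1) + (X 0 1 * q) • colPoly n g (q - 1) := by
  have e00 := congrArg C (congrFun (congrFun h 0) 0)
  have e01 := congrArg C (congrFun (congrFun h 0) 1)
  have e10 := congrArg C (congrFun (congrFun h 1) 0)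
  have e11 := congrArg C (congrFun (congrFun h 1) 1)
  simp only [Matrix.mul_apply, Fin.sum_univ_two, C_add, C_mul] at e00 e01 e10 e11
  obtain ⟨u, rfl⟩ : ∃ u, n = u + q := ⟨n - q, by omega⟩
  have hu : u + q - q = u := by omega
  simp only [smul_eq_C_mul, C_add, C_mul, C_sub]
  -- Differentiating a power lowers its exponent, so zero exponents are treated separately from
  -- successors.
  rcases u with _ | u <;> rcases q with _ | q
  · simp [colPoly]
  · simp only [colPoly, derivative_mul, derivative_pow, derivative_add, derivative_C,
      derivative_X, map_natCast]
    rw [show 0 + (q + 1) - (q + 1) = 0 by omega, show 0 + (q + 1) - (q + 1 - 1) = 1 by omega,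
      show 0 + (q + 1) - (q + 1 + 1) = 0 by omega]
    simp only [Nat.add_sub_cancel]
    push_cast
    linear_combination (exp := 1) (C (g 0 1) + C (g 1 1) * Polynomial.X) ^ q * ((q : ℂ[X]) + 1) *
      (e01 + Polynomial.X * e11)
  · simp only [colPoly, derivative_mul, derivative_pow, derivative_add, derivative_C,
      derivative_X, map_natCast]
    simp only [Nat.add_zero, Nat.zero_add, Nat.sub_zero, Nat.add_sub_cancel]
    push_cast
    linear_combination (exp := 1) (C (g 0 0) + C (g 1 0) * Polynomial.X) ^ u * ((u : ℂ[X]) + 1) *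
      (e00 + Polynomial.X * e10)
  · simp only [colPoly, derivative_mul, derivative_pow, derivative_add, derivative_C,
      derivative_X, map_natCast]
    rw [show u + 1 + (q + 1) - (q + 1) = u + 1 by omega,
      show u + 1 + (q + 1) - (q + 1 - 1) = u + 2 by omega,
      show u + 1 + (q + 1) - (q + 1 + 1) = u by omega]
    simp only [Nat.add_sub_cancel]
    push_cast
    linear_combination (exp := 1) (C (g 0 0) + C (g 1 0) * Polynomial.X) ^ u *
      (C (g 0 1) + C (g 1 1) * Polynomial.X) ^ q *
      (((u : ℂ[X]) + 1) * (C (g 0 1) + C (g 1 1) * Polynomial.X) * (e00 + Polynomial.X * e10) +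
      ((q : ℂ[X]) + 1) * (C (g 0 0) + C (g 1 0) * Polynomial.X) * (e01 + Polynomial.X * e11))

/-- Replaces differentiation of the representation: compare coefficients in `lie_colPoly`, the norm
of the intermediate monomial cancelling in each product. -/
theorem lieRep_mul_spinMatrix (n : ℕ) (g X Y : Matrix (Fin 2) (Fin 2) ℂ) (h : Y * g = g * X) :
    lieRep n Y * spinMatrix n g = spinMatrix n g * lieRep n X := by
  ext r q
  have hq := Nat.lt_succ_iff.mp q.2
  have key := congrArg (fun p => p.coeff (r : ℕ)) (lie_colPoly n g X Y h hq)
  have e1 := sum_lieMon_mul_coeff n Y (colPoly n g q) (colPoly_natDegree n g hq)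
    (Nat.lt_succ_iff.mp r.2)
  have e2 := congrArg (fun p => p.coeff (r : ℕ)) (sum_mul_lieMon n X (colPoly n g) hq)
  have e3 : (Polynomial.X * (colPoly n g q).derivative).coeff (r : ℕ) =
      (r : ℂ) * (colPoly n g q).coeff r := by
    cases (r : ℕ) with
    | zero => simp
    | succ k => rw [Polynomial.coeff_X_mul, Polynomial.coeff_derivative]; push_cast; ring
  simp only [Polynomial.finsetSum_coeff, Polynomial.coeff_add, Polynomial.coeff_smul,
    smul_eq_mul] at e2
  simp only [Polynomial.coeff_add, Polynomial.coeff_C_mul, Polynomial.coeff_sub,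
    Polynomial.coeff_smul, smul_eq_mul, e3] at key
  have e4 : ∑ s : Fin (n + 1), lieMon n Y r s * (colPoly n g q).coeff s =
      ∑ s : Fin (n + 1), lieMon n X s q * (colPoly n g s).coeff r := by
    rw [e1, e2, ← key]
    ring
  have e5 := congrArg (fun z => ((monoNorm n r / monoNorm n q : ℝ) : ℂ) * z) e4
  simp only [Finset.mul_sum] at e5
  rw [Matrix.mul_apply, Matrix.mul_apply]
  refine (Finset.sum_congr rfl fun s _ => ?_).trans (e5.trans (Finset.sum_congr rfl fun s _ => ?_))
  all_goals
    rw [lieRep_apply, spinMatrix, Matrix.of_apply]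
    have hr : ((monoNorm n r : ℝ) : ℂ) ≠ 0 := by exact_mod_cast monoNorm_ne_zero n r
    have hs : ((monoNorm n s : ℝ) : ℂ) ≠ 0 := by exact_mod_cast monoNorm_ne_zero n s
    have hq : ((monoNorm n q : ℝ) : ℂ) ≠ 0 := by exact_mod_cast monoNorm_ne_zero n q
    push_cast
    field_simp

theorem spinRep_mul_inv (n : ℕ) (g : SU2) : spinRep n g * spinRep n g⁻¹ = 1 := by
  rw [← map_mul, mul_inv_cancel, map_one]

theorem spinRep_inv_mul (n : ℕ) (g : SU2) : spinRep n g⁻¹ * spinRep n g = 1 := by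
  rw [← map_mul, inv_mul_cancel, map_one]

theorem actOp_lieRep (n : ℕ) (g : SU2) (X : Matrix (Fin 2) (Fin 2) ℂ) :
    actOp n g (lieRep n X) = lieRep n ((g : Matrix (Fin 2) (Fin 2) ℂ) * X *
      ((g⁻¹ : SU2) : Matrix (Fin 2) (Fin 2) ℂ)) := by
  have h := lieRep_mul_spinMatrix n (g : Matrix (Fin 2) (Fin 2) ℂ) X
    ((g : Matrix (Fin 2) (Fin 2) ℂ) * X * ((g⁻¹ : SU2) : Matrix (Fin 2) (Fin 2) ℂ))
    (by rw [mul_assoc, SU2.inv_mul_coe, mul_one])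
  change spinMatrix n g * lieRep n X * spinRep n g⁻¹ = _
  rw [← h, mul_assoc]
  change _ * (spinRep n g * spinRep n g⁻¹) = _
  rw [spinRep_mul_inv, mul_one]

/-! ### The `sl(2)`-structure of the operator space -/

/-- The operator `2 J₃`. -/
def weightOp (n : ℕ) : Op n := Matrix.diagonal fun q : Fin (n + 1) => (n : ℂ) - 2 * (q : ℕ)

theorem lie_diagonal_apply {n : ℕ} (d : Fin (n + 1) → ℂ) (A : Op n) (r s : Fin (n + 1)) :
    ⁅(Matrix.diagonal d : Op n), A⁆ r s = (d r - d s) * A r s := by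
  rw [Ring.lie_def, Matrix.sub_apply, Matrix.diagonal_mul, Matrix.mul_diagonal]
  ring

theorem lie_weightOp_Jplus (n : ℕ) : ⁅weightOp n, Jplus n⁆ = (2 : ℂ) • Jplus n := by
  ext r s
  rw [weightOp, lie_diagonal_apply, Matrix.smul_apply, smul_eq_mul]
  simp only [Jplus, Matrix.transpose_apply, Jminus, Matrix.of_apply]
  split_ifs with h
  · rw [h]; push_cast; ring
  · simp

theorem lie_weightOp_Jminus (n : ℕ) : ⁅weightOp n, Jminus n⁆ = (-2 : ℂ) • Jminus n := by
  ext r s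
  rw [weightOp, lie_diagonal_apply, Matrix.smul_apply, smul_eq_mul]
  simp only [Jminus, Matrix.of_apply]
  split_ifs with h
  · rw [h]; push_cast; ring
  · simp

theorem lie_Jplus_Jminus (n : ℕ) : ⁅Jplus n, Jminus n⁆ = weightOp n := by
  have hsq : ∀ k : ℕ, k ≤ n → ((Real.sqrt (((n : ℝ) - k) * (k + 1)) : ℝ) : ℂ) *
      ((Real.sqrt (((n : ℝ) - k) * (k + 1)) : ℝ) : ℂ) = ((n : ℂ) - k) * (k + 1) := by
    intro k hk
    have hk' : (k : ℝ) ≤ n := by exact_mod_cast hk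
    rw [← Complex.ofReal_mul, Real.mul_self_sqrt (mul_nonneg (by linarith) (by positivity))]
    push_cast
    ring
  ext r s
  have hr := Nat.lt_succ_iff.mp r.2
  have hs := Nat.lt_succ_iff.mp s.2
  rw [Ring.lie_def, Matrix.sub_apply, Matrix.mul_apply, Matrix.mul_apply]
  simp only [Jplus, Matrix.transpose_apply, Jminus, Matrix.of_apply]
  rw [Fin.sum_univ_eq_sum_range (fun k =>
      (if k = (r : ℕ) + 1 then ((Real.sqrt (((n : ℝ) - (r : ℕ)) * ((r : ℕ) + 1)) : ℝ) : ℂ) else 0) *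
      (if k = (s : ℕ) + 1 then ((Real.sqrt (((n : ℝ) - (s : ℕ)) * ((s : ℕ) + 1)) : ℝ) : ℂ) else 0)),
    Fin.sum_univ_eq_sum_range (fun k =>
      (if (r : ℕ) = k + 1 then ((Real.sqrt (((n : ℝ) - k) * (k + 1)) : ℝ) : ℂ) else 0) *
      (if (s : ℕ) = k + 1 then ((Real.sqrt (((n : ℝ) - k) * (k + 1)) : ℝ) : ℂ) else 0))]
  simp only [ite_mul, zero_mul]
  rw [Finset.sum_ite_eq']
  by_cases h : r = s
  · subst h
    have e1 : (if (r : ℕ) + 1 ∈ Finset.range (n + 1) then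
        ((Real.sqrt (((n : ℝ) - (r : ℕ)) * ((r : ℕ) + 1)) : ℝ) : ℂ) *
        if (r : ℕ) + 1 = r + 1 then ((Real.sqrt (((n : ℝ) - (r : ℕ)) * ((r : ℕ) + 1)) : ℝ) : ℂ)
          else 0 else 0) = ((n : ℂ) - (r : ℕ)) * ((r : ℕ) + 1) := by
      rw [if_pos rfl, hsq r hr]
      split_ifs with h
      · rfl
      · have : (r : ℕ) = n := by simp at h; omega
        simp [this]
    rw [e1, weightOp, Matrix.diagonal_apply_eq]
    rcases hk : (r : ℕ) with _ | k
    · simp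
    · simp only [add_left_inj]
      rw [Finset.sum_ite_eq, if_pos (by simp; omega), if_pos rfl, hsq k (by omega)]
      push_cast
      ring
  · have h' : (r : ℕ) ≠ s := fun e => h (Fin.ext e)
    rw [weightOp, Matrix.diagonal_apply_ne _ h, Finset.sum_eq_zero]
    · simp [h']
    · intro k _
      split_ifs <;> first | rfl | omega | simp

theorem lie_Jplus_pow (n l : ℕ) : ⁅Jplus n, Jplus n ^ l⁆ = 0 := by
  rw [Ring.lie_def, ← pow_succ, ← pow_succ', sub_self]

theorem lie_weightOp_Jplus_pow (n l : ℕ) :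
    ⁅weightOp n, Jplus n ^ l⁆ = (2 * l : ℂ) • Jplus n ^ l := by
  induction l with
  | zero => simp [Ring.lie_def]
  | succ l ih =>
    have h1 := lie_weightOp_Jplus n
    rw [Ring.lie_def] at ih h1 ⊢
    calc weightOp n * Jplus n ^ (l + 1) - Jplus n ^ (l + 1) * weightOp n =
        (weightOp n * Jplus n ^ l - Jplus n ^ l * weightOp n) * Jplus n +
          Jplus n ^ l * (weightOp n * Jplus n - Jplus n * weightOp n) := by
          rw [pow_succ]; noncomm_ring
      _ = _ := by
        rw [ih, h1, smul_mul_assoc, mul_smul_comm, ← pow_succ, ← add_smul]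
        push_cast
        congr 1
        ring

/-- The vectors `ad(J₋)^k (J₊^l)`, which for `k ≤ 2l`, `l ≤ n` are, up to normalization, the
coupled standard basis vectors `e^j(l, l - k)`. -/
def coupledVec (n l k : ℕ) : Op n := (LieAlgebra.ad ℂ (Op n) (Jminus n) ^ k) (Jplus n ^ l)

theorem coupledVec_zero (n l : ℕ) : coupledVec n l 0 = Jplus n ^ l := rfl

theorem lie_Jminus_coupledVec (n l k : ℕ) :
    ⁅Jminus n, coupledVec n l k⁆ = coupledVec n l (k + 1) := by
  rw [coupledVec, coupledVec, pow_succ', Module.End.mul_apply, LieAlgebra.ad_apply]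

theorem lie_weightOp_coupledVec (n l k : ℕ) :
    ⁅weightOp n, coupledVec n l k⁆ = (2 * l - 2 * k : ℂ) • coupledVec n l k := by
  induction k with
  | zero => simpa [coupledVec_zero] using lie_weightOp_Jplus_pow n l
  | succ k ih =>
    rw [← lie_Jminus_coupledVec, leibniz_lie, ih, lie_weightOp_Jminus, smul_lie, lie_smul,
      ← add_smul]
    push_cast
    congr 1
    ring

/-- The usual ladder computation from a highest weight vector of weight `2l`, using `[J₊, J₋] = 2J₃`
and the Jacobi identity. -/
theorem lie_Jplus_coupledVec (n l k : ℕ) :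
    ⁅Jplus n, coupledVec n l (k + 1)⁆ = ((k + 1) * (2 * l - k) : ℂ) • coupledVec n l k := by
  induction k with
  | zero =>
    rw [← lie_Jminus_coupledVec, leibniz_lie, lie_Jplus_Jminus, lie_weightOp_coupledVec,
      coupledVec_zero, lie_Jplus_pow, lie_zero]
    push_cast
    module
  | succ k ih =>
    rw [← lie_Jminus_coupledVec, leibniz_lie, lie_Jplus_Jminus, lie_weightOp_coupledVec, ih,
      lie_smul, lie_Jminus_coupledVec, ← add_smul]
    push_cast
    congr 1
    ring

/-- The entries of `J₋^l`. -/
theorem Jminus_pow_apply (n l : ℕ) (r s : Fin (n + 1)) :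
    (Jminus n ^ l) r s = if (r : ℕ) = s + l then
      ((monoNorm n r / monoNorm n s * ((n - s).descFactorial l : ℕ) : ℝ) : ℂ) else 0 := by
  induction l generalizing r with
  | zero =>
    by_cases h : r = s
    · subst h
      simp [div_self (monoNorm_ne_zero n r)]
    · have h' : (r : ℕ) ≠ s := fun e => h (Fin.ext e)
      simp [Matrix.one_apply_ne h, h']
  | succ l ih =>
    rw [pow_succ', Matrix.mul_apply]
    simp only [ih]
    simp only [Jminus, Matrix.of_apply]
    split_ifs with h
    · have hlt : (s : ℕ) + l < n := by have := r.2; omega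
      rw [Finset.sum_eq_single (⟨(s : ℕ) + l, by omega⟩ : Fin (n + 1))]
      · rw [if_pos (by simp; omega), if_pos rfl, sqrt_eq_monoNorm_div n _ hlt, ← Complex.ofReal_mul,
          h, Nat.descFactorial_succ]
        have h1 := monoNorm_ne_zero n (s + l)
        have h2 := monoNorm_ne_zero n s
        have e : ((n - s - l : ℕ) : ℝ) = n - (s + l : ℕ) := by
          rw [Nat.sub_sub, Nat.cast_sub hlt.le]
        congr 1
        push_cast at e ⊢
        rw [e, ← add_assoc]
        field_simp
      · intro k _ hk
        rw [if_neg, zero_mul]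
        intro hk'
        apply hk
        apply Fin.ext
        simp
        omega
      · simp
    · apply Finset.sum_eq_zero
      intro k _
      split_ifs <;> first | omega | simp

/-- Coefficient of `x^m` in `(1-x)^{-(l+1)} (1-x)^{-(l+1)} = (1-x)^{-(2l+2)}`. -/
theorem sum_choose_mul_choose (m l : ℕ) :
    ∑ s ∈ Finset.range (m + 1), (s + l).choose l * (m - s + l).choose l =
      (m + 2 * l + 1).choose (2 * l + 1) := by
  have h := congrArg Units.val (PowerSeries.invOneSubPow_add ℤ (l + 1) (l + 1))
  rw [show l + 1 + (l + 1) = (2 * l + 1) + 1 by ring, Units.val_mul,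
    PowerSeries.invOneSubPow_val_succ_eq_mk_add_choose,
    PowerSeries.invOneSubPow_val_succ_eq_mk_add_choose] at h
  have h2 := congrArg (PowerSeries.coeff m) h
  rw [PowerSeries.coeff_mul, Finset.Nat.sum_antidiagonal_eq_sum_range_succ_mk] at h2
  simp only [PowerSeries.coeff_mk] at h2
  rw [show m + 2 * l + 1 = 2 * l + 1 + m by ring]
  zify
  rw [h2]
  refine Finset.sum_congr rfl fun s _ => ?_
  rw [add_comm s l, add_comm (m - s) l]

/-- The trace is the sum of the squared entries of `J₋^l`. Column `s ≤ n - l` has a single nonzero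
entry, with square `l!² C(s+l, l) C(n-s, l)`; the other columns vanish. -/
theorem trace_Jminus_pow_mul_Jplus_pow {n l : ℕ} (hl : l ≤ n) :
    (Jminus n ^ l * Jplus n ^ l).trace =
      ((l.factorial ^ 2 * (n + l + 1).choose (2 * l + 1) : ℕ) : ℂ) := by
  have e1 : (Jminus n ^ l * Jplus n ^ l).trace =
      ∑ s : Fin (n + 1), ∑ r : Fin (n + 1), (Jminus n ^ l) r s * (Jminus n ^ l) r s := by
    rw [Jplus, ← Matrix.transpose_pow, Matrix.trace, Finset.sum_comm]
    rfl
  have e2 : ∀ s : Fin (n + 1), ∑ r : Fin (n + 1), (Jminus n ^ l) r s * (Jminus n ^ l) r s =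
      if (s : ℕ) < n - l + 1 then
        ((l.factorial ^ 2 * ((s + l).choose l * (n - l - s + l).choose l) : ℕ) : ℂ) else 0 := by
    intro s
    simp only [Jminus_pow_apply]
    split_ifs with h
    · have hle : (s : ℕ) + l ≤ n := by omega
      rw [Finset.sum_eq_single (⟨(s : ℕ) + l, by omega⟩ : Fin (n + 1))]
      · rw [if_pos rfl, ← Complex.ofReal_mul, ← Complex.ofReal_natCast]
        congr 1
        obtain ⟨m, hm⟩ : ∃ m, n = s + l + m := ⟨n - (s + l), by omega⟩
        have h1 := monoNorm_sq n (s + l)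
        have h2 := monoNorm_sq n s
        have h3 := monoNorm_ne_zero n s
        simp only
        rw [show n - (s + l) = m by omega] at h1
        rw [show n - (s : ℕ) = m + l by omega] at h2 ⊢
        rw [show n - l - s + l = m + l by omega]
        have h4 := Nat.add_choose_mul_factorial_mul_factorial (s : ℕ) l
        have h5 := Nat.descFactorial_eq_factorial_mul_choose (m + l) l
        have h6 := Nat.factorial_mul_descFactorial (Nat.le_add_left l m)
        rw [Nat.add_sub_cancel] at h6
        have h4' : (((s : ℕ) + l).choose l : ℝ) * (s : ℕ).factorial * l.factorial =
          ((s : ℕ) + l).factorial := by exact_mod_cast h4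
        have h5' : ((m + l).descFactorial l : ℝ) = l.factorial * (m + l).choose l := by
          exact_mod_cast h5
        have h6' : (m.factorial : ℝ) * (m + l).descFactorial l = (m + l).factorial := by
          exact_mod_cast h6
        have e3 : monoNorm n (s + l) / monoNorm n s * ((m + l).descFactorial l : ℕ) *
            (monoNorm n (s + l) / monoNorm n s * ((m + l).descFactorial l : ℕ)) =
            monoNorm n (s + l) ^ 2 / monoNorm n s ^ 2 * ((m + l).descFactorial l : ℝ) ^ 2 := by
          ring
        rw [e3, h1, h2, ← h6', ← h4', h5']
        have h7 : (m.factorial : ℝ) ≠ 0 := by positivity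
        have h8 : ((s : ℕ).factorial : ℝ) ≠ 0 := by positivity
        have h9 : (l.factorial : ℝ) ≠ 0 := by positivity
        have h10 : ((m + l).choose l : ℝ) ≠ 0 := by
          exact_mod_cast (Nat.choose_pos (Nat.le_add_left l m)).ne'
        push_cast
        field_simp
      · intro k _ hk
        rw [if_neg, zero_mul]
        intro hk'
        exact hk (Fin.ext hk')
      · simp
    · apply Finset.sum_eq_zero
      intro r _
      rw [if_neg (by have := r.2; omega), zero_mul]
  rw [e1, Finset.sum_congr rfl fun s _ => e2 s, Fin.sum_univ_eq_sum_range (fun s =>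
    if s < n - l + 1 then
      ((l.factorial ^ 2 * ((s + l).choose l * (n - l - s + l).choose l) : ℕ) : ℂ) else 0),
    ← Finset.sum_filter]
  rw [show (Finset.range (n + 1)).filter (fun s => s < n - l + 1) = Finset.range (n - l + 1) by
    ext s; simp; omega]
  rw [← Nat.cast_sum, ← Finset.mul_sum, sum_choose_mul_choose,
    show n - l + 2 * l + 1 = n + l + 1 by omega]

theorem Jplus_pow_ne_zero {n l : ℕ} (hl : l ≤ n) : Jplus n ^ l ≠ 0 := by
  intro h
  have h1 := trace_Jminus_pow_mul_Jplus_pow hl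
  rw [h, mul_zero, Matrix.trace_zero] at h1
  have h2 : 0 < l.factorial ^ 2 * (n + l + 1).choose (2 * l + 1) :=
    mul_pos (by positivity) (Nat.choose_pos (by omega))
  exact h2.ne' (by exact_mod_cast h1.symm)

/-- `J₊` brings each vector back to the preceding one with factor `(k+1)(2l-k)`, nonzero while `k <
2l`. -/
theorem coupledVec_ne_zero {n l k : ℕ} (hl : l ≤ n) (hk : k ≤ 2 * l) : coupledVec n l k ≠ 0 := by
  induction k with
  | zero => exact Jplus_pow_ne_zero hl
  | succ k ih =>
    intro h
    have h1 := lie_Jplus_coupledVec n l k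
    rw [h, lie_zero, eq_comm, smul_eq_zero] at h1
    rcases h1 with h1 | h1
    · rcases mul_eq_zero.mp h1 with h2 | h2
      · exact Nat.cast_add_one_ne_zero k h2
      · have : 2 * l = k := by exact_mod_cast sub_eq_zero.mp h2
        omega
    · exact ih (by omega) h1

/-! ### The Casimir operator and the coupled basis -/

/-- `P ↦ P^g` as a linear map. -/
def actLin (n : ℕ) (g : SU2) : Op n →ₗ[ℂ] Op n where
  toFun := actOp n g
  map_add' P Q := by simp only [actOp, mul_add, add_mul]
  map_smul' a P := by simp only [actOp, mul_smul_comm, smul_mul_assoc, RingHom.id_apply]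

theorem actLin_apply (n : ℕ) (g : SU2) (P : Op n) : actLin n g P = actOp n g P := rfl

theorem actOp_mul (n : ℕ) (g : SU2) (P Q : Op n) :
    actOp n g (P * Q) = actOp n g P * actOp n g Q := by
  simp only [actOp, mul_assoc]
  rw [← mul_assoc (spinRep n g⁻¹) (spinRep n g), spinRep_inv_mul, one_mul]

theorem actOp_one (n : ℕ) (g : SU2) : actOp n g 1 = 1 := by
  rw [actOp, mul_one, spinRep_mul_inv]

theorem actOp_actOp (n : ℕ) (g h : SU2) (P : Op n) :
    actOp n g (actOp n h P) = actOp n (g * h) P := by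
  simp only [actOp, map_mul, mul_inv_rev, mul_assoc]

theorem actOp_id (n : ℕ) (P : Op n) : actOp n 1 P = P := by
  simp [actOp]

theorem trace_actOp (n : ℕ) (g : SU2) (P : Op n) : (actOp n g P).trace = P.trace := by
  rw [actOp, Matrix.trace_mul_comm, ← mul_assoc, spinRep_inv_mul, one_mul]

theorem trace_actOp_mul (n : ℕ) (g : SU2) (P Q : Op n) :
    (actOp n g P * Q).trace = (P * actOp n g⁻¹ Q).trace := by
  rw [← trace_actOp n g (P * actOp n g⁻¹ Q), actOp_mul, actOp_actOp, mul_inv_cancel, actOp_id]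

theorem actOp_lie (n : ℕ) (g : SU2) (P Q : Op n) :
    actOp n g ⁅P, Q⁆ = ⁅actOp n g P, actOp n g Q⁆ := by
  rw [Ring.lie_def, Ring.lie_def, ← actLin_apply, map_sub, actLin_apply, actLin_apply, actOp_mul,
    actOp_mul]

/-- The Casimir operator of `gl(2)` acting on operators. -/
def casimir (n : ℕ) : Op n →ₗ[ℂ] Op n :=
  ∑ a : Fin 2, ∑ b : Fin 2, LieAlgebra.ad ℂ (Op n) (lieRep n (Matrix.single a b 1)) ∘ₗ
    LieAlgebra.ad ℂ (Op n) (lieRep n (Matrix.single b a 1))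

theorem casimir_apply (n : ℕ) (P : Op n) : casimir n P = ∑ a : Fin 2, ∑ b : Fin 2,
    ⁅lieRep n (Matrix.single a b 1), ⁅lieRep n (Matrix.single b a 1), P⁆⁆ := by
  simp [casimir]

/-- The tensor `∑ E_ab ⊗ E_ba` pairs a basis with its dual for the trace form, hence is invariant
under conjugation. This makes the Casimir operator commute with the group. -/
theorem sum_bilin_single_conj {ι V : Type*} [Fintype ι] [DecidableEq ι] [AddCommGroup V]
    [Module ℂ V] (B : Matrix ι ι ℂ →ₗ[ℂ] Matrix ι ι ℂ →ₗ[ℂ] V) {g h : Matrix ι ι ℂ}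
    (hgh : g * h = 1) :
    ∑ a, ∑ b, B (g * Matrix.single a b 1 * h) (g * Matrix.single b a 1 * h) =
      ∑ a, ∑ b, B (Matrix.single a b 1) (Matrix.single b a 1) := by
  have h1 : ∀ a b, g * Matrix.single a b 1 * h =
      ∑ p : ι × ι, (g p.1 a * h b p.2) • Matrix.single p.1 p.2 (1 : ℂ) := by
    intro a b
    rw [Matrix.matrix_eq_sum_single (g * Matrix.single a b 1 * h), Fintype.sum_prod_type]
    refine Finset.sum_congr rfl fun c _ => Finset.sum_congr rfl fun d _ => ?_
    rw [Matrix.smul_single, smul_eq_mul, mul_one]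
    congr 1
    rw [Matrix.mul_apply, Finset.sum_eq_single b]
    · simp
    · intro k _ hk
      rw [Matrix.mul_single_apply_of_ne _ _ _ _ _ hk, zero_mul]
    · simp
  have h2 : ∀ c f, ∑ a, g c a * h a f = if c = f then 1 else 0 := by
    intro c f
    rw [← Matrix.mul_apply, hgh, Matrix.one_apply]
  have h3 : ∀ x : ι × ι, B (g * Matrix.single x.1 x.2 1 * h) (g * Matrix.single x.2 x.1 1 * h) =
      ∑ p : ι × ι, ∑ q : ι × ι, ((g p.1 x.1 * h x.1 q.2) * (g q.1 x.2 * h x.2 p.2)) •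
        B (Matrix.single p.1 p.2 1) (Matrix.single q.1 q.2 1) := by
    intro x
    rw [h1 x.1 x.2, map_sum, LinearMap.sum_apply]
    refine Finset.sum_congr rfl fun p _ => ?_
    rw [h1 x.2 x.1, map_smul, LinearMap.smul_apply, map_sum, Finset.smul_sum]
    refine Finset.sum_congr rfl fun q _ => ?_
    rw [map_smul, smul_smul]
    congr 1
    ring
  have h4 : ∀ p q : ι × ι,
      ∑ x : ι × ι, (g p.1 x.1 * h x.1 q.2) * (g q.1 x.2 * h x.2 p.2) =
        if q = (p.2, p.1) then 1 else 0 := by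
    intro p q
    rw [Fintype.sum_prod_type]
    simp only [← Finset.mul_sum, h2, ← Finset.sum_mul]
    obtain ⟨q1, q2⟩ := q
    by_cases e1 : q1 = p.2 <;> by_cases e2 : q2 = p.1 <;> simp [e1, e2, eq_comm]
  rw [← Fintype.sum_prod_type' fun a b => B (g * Matrix.single a b 1 * h)
      (g * Matrix.single b a 1 * h), ← Fintype.sum_prod_type' fun a b => B (Matrix.single a b 1)
      (Matrix.single b a 1), Finset.sum_congr rfl fun x _ => h3 x, Finset.sum_comm]
  refine Finset.sum_congr rfl fun p _ => ?_
  rw [Finset.sum_comm]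
  simp only [← Finset.sum_smul, h4, ite_smul, one_smul, zero_smul]
  simp

theorem casimir_actOp (n : ℕ) (g : SU2) (P : Op n) :
    casimir n (actOp n g P) = actOp n g (casimir n P) := by
  have h := sum_bilin_single_conj (LinearMap.mk₂ ℂ
    (fun X Y => ⁅lieRep n X, ⁅lieRep n Y, actOp n g P⁆⁆)
    (by intros; rw [map_add, add_lie]) (by intros; rw [map_smul, smul_lie])
    (by intros; rw [map_add, add_lie, lie_add]) (by intros; rw [map_smul, smul_lie, lie_smul]))
    (SU2.mul_inv_coe g)
  simp only [LinearMap.mk₂_apply] at h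
  rw [casimir_apply, ← h, casimir_apply, ← actLin_apply n g (∑ _, _)]
  simp only [map_sum, actLin_apply, actOp_lie, actOp_lieRep]

theorem lieRep_single_zero_one (n : ℕ) : lieRep n (Matrix.single 0 1 1) = Jplus n := by
  simp [lieRep]

theorem lieRep_single_one_zero (n : ℕ) : lieRep n (Matrix.single 1 0 1) = Jminus n := by
  simp [lieRep]

theorem lie_lieRep_single_zero_zero (n : ℕ) (P : Op n) :
    ⁅lieRep n (Matrix.single 0 0 1), P⁆ = (1 / 2 : ℂ) • ⁅weightOp n, P⁆ := by
  ext r s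
  have : lieRep n (Matrix.single 0 0 1) =
      Matrix.diagonal fun q : Fin (n + 1) => (n : ℂ) - (q : ℕ) := by simp [lieRep]
  rw [this, weightOp, Matrix.smul_apply, lie_diagonal_apply, lie_diagonal_apply, smul_eq_mul]
  ring

theorem lie_lieRep_single_one_one (n : ℕ) (P : Op n) :
    ⁅lieRep n (Matrix.single 1 1 1), P⁆ = (-(1 / 2) : ℂ) • ⁅weightOp n, P⁆ := by
  ext r s
  have : lieRep n (Matrix.single 1 1 1) =
      Matrix.diagonal fun q : Fin (n + 1) => ((q : ℕ) : ℂ) := by simp [lieRep]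
  rw [this, weightOp, Matrix.smul_apply, lie_diagonal_apply, lie_diagonal_apply, smul_eq_mul]
  ring

theorem casimir_eq (n : ℕ) (P : Op n) : casimir n P = (1 / 2 : ℂ) • ⁅weightOp n, ⁅weightOp n, P⁆⁆ +
    ⁅Jplus n, ⁅Jminus n, P⁆⁆ + ⁅Jminus n, ⁅Jplus n, P⁆⁆ := by
  rw [casimir_apply]
  simp only [Fin.sum_univ_two]
  rw [lie_lieRep_single_zero_zero, lie_lieRep_single_zero_zero, lie_lieRep_single_one_one,
    lie_lieRep_single_one_one, lieRep_single_zero_one, lieRep_single_one_zero, lie_smul, lie_smul]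
  module

theorem casimir_coupledVec (n l k : ℕ) :
    casimir n (coupledVec n l k) = (2 * l * (l + 1) : ℂ) • coupledVec n l k := by
  rw [casimir_eq, lie_weightOp_coupledVec, lie_smul, lie_weightOp_coupledVec,
    lie_Jminus_coupledVec, lie_Jplus_coupledVec]
  cases k with
  | zero =>
    rw [coupledVec_zero, lie_Jplus_pow, lie_zero, smul_smul, smul_smul, add_zero, ← add_smul]
    push_cast
    congr 1
    ring
  | succ k =>
    rw [lie_Jplus_coupledVec, lie_smul, lie_Jminus_coupledVec, smul_smul, smul_smul, ← add_smul,
      ← add_smul]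
    push_cast
    congr 1
    ring

theorem trace_lie_mul (n : ℕ) (A P Q : Op n) : (⁅A, P⁆ * Q).trace = -(P * ⁅A, Q⁆).trace := by
  rw [Ring.lie_def, Ring.lie_def, sub_mul, mul_sub, Matrix.trace_sub, Matrix.trace_sub,
    Matrix.mul_assoc, Matrix.trace_mul_comm A (P * Q), Matrix.mul_assoc, Matrix.mul_assoc]
  ring

/-- Each `ad` is skew for the bilinear form `trace(PQ)`, and the Casimir operator is built from
products of two of them. So distinct Casimir eigenspaces are orthogonal. -/
theorem trace_casimir_mul (n : ℕ) (P Q : Op n) :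
    (casimir n P * Q).trace = (P * casimir n Q).trace := by
  simp only [casimir_eq, add_mul, mul_add, smul_mul_assoc, mul_smul_comm, Matrix.trace_add,
    Matrix.trace_smul, trace_lie_mul, neg_neg]
  ring

theorem trace_mul_eq_zero_of_casimir {n : ℕ} {P Q : Op n} {a b : ℂ} (hP : casimir n P = a • P)
    (hQ : casimir n Q = b • Q) (hab : a ≠ b) : (P * Q).trace = 0 := by
  have h := trace_casimir_mul n P Q
  rw [hP, hQ, smul_mul_assoc, mul_smul_comm, Matrix.trace_smul, Matrix.trace_smul, smul_eq_mul,
    smul_eq_mul] at h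
  have h2 : (a - b) * (P * Q).trace = 0 := by linear_combination h
  exact (mul_eq_zero.mp h2).resolve_left (sub_ne_zero.mpr hab)

theorem casimir_eigenvalue_injective {l m : ℕ}
    (h : (2 * l * (l + 1) : ℂ) = 2 * m * (m + 1)) : l = m := by
  have h' : 2 * l * (l + 1) = 2 * m * (m + 1) := by exact_mod_cast h
  rcases lt_trichotomy l m with h1 | h1 | h1
  · nlinarith
  · exact h1
  · nlinarith

/-- The index set of the coupled basis. -/
abbrev CoupledIndex (n : ℕ) : Type := Σ l : Fin (n + 1), Fin (2 * (l : ℕ) + 1)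

theorem card_coupledIndex (n : ℕ) : Fintype.card (CoupledIndex n) = (n + 1) * (n + 1) := by
  rw [Fintype.card_sigma]
  simp only [Fintype.card_fin]
  rw [Fin.sum_univ_eq_sum_range (fun l => 2 * l + 1)]
  induction n with
  | zero => rfl
  | succ n ih => rw [Finset.sum_range_succ, ih]; ring

/-- An operator with simple spectrum on the coupled basis. -/
def splitter (n : ℕ) : Module.End ℂ (Op n) := casimir n + LieAlgebra.ad ℂ (Op n) (weightOp n)

/-- The eigenvalues of `splitter n`. -/
def splitValue (n : ℕ) (i : CoupledIndex n) : ℂ :=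
  2 * (i.1 : ℕ) * ((i.1 : ℕ) + 1) + (2 * (i.1 : ℕ) - 2 * (i.2 : ℕ))

theorem splitter_coupledVec (n : ℕ) (i : CoupledIndex n) :
    splitter n (coupledVec n i.1 i.2) = splitValue n i • coupledVec n i.1 i.2 := by
  rw [splitter, LinearMap.add_apply, LieAlgebra.ad_apply, casimir_coupledVec,
    lie_weightOp_coupledVec, ← add_smul, splitValue]

/-- Half the value is `l² + 2l - k`, which for `0 ≤ k ≤ 2l` runs through the interval from `l²` to
`(l+1)² - 1`; these intervals are disjoint. -/
theorem splitValue_injective (n : ℕ) : Function.Injective (splitValue n) := by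
  rintro ⟨⟨l, hl⟩, ⟨k, hk⟩⟩ ⟨⟨m, hm⟩, ⟨j, hj⟩⟩ h
  simp only [splitValue] at h hk hj
  have h1 : l * (l + 1) + l + j = m * (m + 1) + m + k := by
    have : ((l * (l + 1) + l + j : ℕ) : ℂ) = ((m * (m + 1) + m + k : ℕ) : ℂ) := by
      push_cast
      linear_combination (1 / 2) * h
    exact_mod_cast this
  obtain rfl : l = m := by
    rcases lt_trichotomy l m with h2 | h2 | h2
    · nlinarith
    · exact h2
    · nlinarith
  obtain rfl : k = j := by omega
  rfl

/-- The coupled basis of the operator space. -/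
def coupledBasis (n : ℕ) : Module.Basis (CoupledIndex n) ℂ (Op n) :=
  basisOfLinearIndependentOfCardEqFinrank
    (b := fun i : CoupledIndex n => coupledVec n i.1 i.2)
    -- Eigenvectors for distinct eigenvalues are independent, and there are `∑ (2l+1) = (n+1)²` of
    -- them.
    (Module.End.eigenvectors_linearIndependent' (splitter n) (splitValue n)
      (splitValue_injective n) _ fun i =>
        Module.End.hasEigenvector_iff.mpr ⟨Module.End.mem_eigenspace_iff.mpr
          (splitter_coupledVec n i), coupledVec_ne_zero (Nat.lt_succ_iff.mp i.1.2)
            (Nat.lt_succ_iff.mp i.2.2)⟩)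
    (by rw [card_coupledIndex, Module.finrank_matrix]; simp)

theorem coupledBasis_apply (n : ℕ) (i : CoupledIndex n) :
    coupledBasis n i = coupledVec n i.1 i.2 := by
  rw [coupledBasis, coe_basisOfLinearIndependentOfCardEqFinrank]

/-! ### The diagonal coupled vectors -/

/-- A vector of weight zero commutes with `2J₃`, whose diagonal entries are distinct. -/
theorem coupledVec_isDiag (n l : ℕ) : (coupledVec n l l).IsDiag := by
  intro r s hrs
  have h := congrFun (congrFun (lie_weightOp_coupledVec n l l) r) s
  rw [sub_self, zero_smul, weightOp, lie_diagonal_apply, Matrix.zero_apply] at h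
  refine (mul_eq_zero.mp h).resolve_left fun h1 => hrs (Fin.ext ?_)
  have h2 : ((r : ℕ) : ℂ) = ((s : ℕ) : ℂ) := by linear_combination (-1 / 2) * h1
  exact_mod_cast h2

theorem Jminus_map_conj (n : ℕ) : (Jminus n).map (starRingEnd ℂ) = Jminus n := by
  ext r s
  simp only [Matrix.map_apply, Jminus, Matrix.of_apply]
  split_ifs
  · exact Complex.conj_ofReal _
  · simp

theorem Jplus_map_conj (n : ℕ) : (Jplus n).map (starRingEnd ℂ) = Jplus n := by
  rw [Jplus, Matrix.transpose_map, Jminus_map_conj]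

theorem coupledVec_map_conj (n l k : ℕ) :
    (coupledVec n l k).map (starRingEnd ℂ) = coupledVec n l k := by
  induction k with
  | zero =>
    change (starRingEnd ℂ).mapMatrix (Jplus n ^ l) = Jplus n ^ l
    rw [map_pow]
    change (Jplus n).map (starRingEnd ℂ) ^ l = _
    rw [Jplus_map_conj]
  | succ k ih =>
    rw [← lie_Jminus_coupledVec, Ring.lie_def]
    change (starRingEnd ℂ).mapMatrix _ = _
    rw [map_sub, map_mul, map_mul]
    change (Jminus n).map _ * (coupledVec n l k).map _ - (coupledVec n l k).map _ *
      (Jminus n).map _ = _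
    rw [ih, Jminus_map_conj]

theorem coupledVec_conjTranspose (n l : ℕ) :
    (coupledVec n l l).conjTranspose = coupledVec n l l := by
  have h1 : (coupledVec n l l).conjTranspose =
      ((coupledVec n l l).map (starRingEnd ℂ)).transpose := rfl
  rw [h1, coupledVec_map_conj, ← (coupledVec_isDiag n l).diagonal_diag, Matrix.diagonal_transpose]

/-- Transposition exchanges `J₋` and `J₊`, so each step down the ladder multiplies the norm by
`(k+1)(2l-k)`. -/
theorem trace_transpose_coupledVec_mul_self (n l k : ℕ) (hl : l ≤ n) (hk : k ≤ 2 * l) :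
    ((coupledVec n l k).transpose * coupledVec n l k).trace =
      ((k.factorial * (2 * l).descFactorial k *
        (l.factorial ^ 2 * (n + l + 1).choose (2 * l + 1)) : ℕ) : ℂ) := by
  induction k with
  | zero =>
    rw [coupledVec_zero, Matrix.transpose_pow, Jplus, Matrix.transpose_transpose, ← Jplus,
      trace_Jminus_pow_mul_Jplus_pow hl]
    simp
  | succ k ih =>
    have h1 : (coupledVec n l (k + 1)).transpose = -⁅Jplus n, (coupledVec n l k).transpose⁆ := by
      rw [← lie_Jminus_coupledVec, Ring.lie_def, Ring.lie_def, Matrix.transpose_sub,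
        Matrix.transpose_mul, Matrix.transpose_mul, neg_sub]
      rfl
    rw [h1, neg_mul, Matrix.trace_neg, trace_lie_mul, neg_neg, lie_Jplus_coupledVec,
      mul_smul_comm, Matrix.trace_smul, ih (by omega), Nat.factorial_succ, Nat.descFactorial_succ,
      smul_eq_mul]
    push_cast [Nat.cast_sub (show k ≤ 2 * l by omega)]
    ring

/-- Binomial theorem for `ad(J₋)`, a difference of the commuting left and right multiplications. It
ties the explicit formula for `e^j(l,0)` to the ladder. -/
theorem coupledVec_eq_sum (n l k : ℕ) : coupledVec n l k = ∑ i ∈ Finset.range (k + 1),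
    ((-1) ^ i * (k.choose i : ℂ)) • (Jminus n ^ (k - i) * Jplus n ^ l * Jminus n ^ i) := by
  have h1 : LieAlgebra.ad ℂ (Op n) (Jminus n) =
      -LinearMap.mulRight ℂ (Jminus n) + LinearMap.mulLeft ℂ (Jminus n) := by
    ext1 A
    simp [Ring.lie_def]
    abel
  have h2 : Commute (-LinearMap.mulRight ℂ (Jminus n)) (LinearMap.mulLeft ℂ (Jminus n)) :=
    (LinearMap.commute_mulLeft_right (R := ℂ) (Jminus n) (Jminus n)).symm.neg_left
  rw [coupledVec, h1, h2.add_pow, LinearMap.sum_apply]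
  refine Finset.sum_congr rfl fun i _ => ?_
  rw [neg_pow (LinearMap.mulRight ℂ (Jminus n)), LinearMap.pow_mulRight, LinearMap.pow_mulLeft,
    ← nsmul_eq_mul']
  rw [LinearMap.smul_apply, mul_assoc, Module.End.mul_apply, Module.End.mul_apply,
    LinearMap.mulRight_apply, LinearMap.mulLeft_apply]
  rcases Nat.even_or_odd i with h | h <;> simp [h.neg_one_pow, Nat.cast_smul_eq_nsmul]

/-- The normalization factor of `e^j(l, 0)`. -/
def coupledFactor (n l : ℕ) : ℝ :=
  (-1) ^ l / (l.factorial : ℝ) * Real.sqrt (2 * l + 1) *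
    Real.sqrt (((n - l).factorial : ℝ) / ((n + l + 1).factorial : ℝ))

theorem coupledZero_eq (n l : ℕ) :
    coupledZero n l = ((coupledFactor n l : ℝ) : ℂ) • coupledVec n l l := by
  rw [coupledVec_eq_sum]
  rfl

theorem coupledFactor_sq (n l : ℕ) : coupledFactor n l ^ 2 =
    (2 * l + 1) / (l.factorial : ℝ) ^ 2 *
      (((n - l).factorial : ℝ) / ((n + l + 1).factorial : ℝ)) := by
  rw [coupledFactor, mul_pow, mul_pow, Real.sq_sqrt (by positivity), Real.sq_sqrt (by positivity),
    div_pow, ← pow_mul, mul_comm l 2, pow_mul, neg_one_sq, one_pow]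
  ring

theorem coupledZero_isDiag (n l : ℕ) : (coupledZero n l).IsDiag := by
  rw [coupledZero_eq]
  exact (coupledVec_isDiag n l).smul _

theorem coupledZero_conjTranspose (n l : ℕ) :
    (coupledZero n l).conjTranspose = coupledZero n l := by
  rw [coupledZero_eq, Matrix.conjTranspose_smul, coupledVec_conjTranspose]
  congr 1
  exact Complex.conj_ofReal _

theorem casimir_coupledZero (n l : ℕ) :
    casimir n (coupledZero n l) = (2 * l * (l + 1) : ℂ) • coupledZero n l := by
  rw [coupledZero_eq, map_smul, casimir_coupledVec, smul_comm]

theorem trace_coupledZero_mul_self {n l : ℕ} (hl : l ≤ n) :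
    (coupledZero n l * coupledZero n l).trace = 1 := by
  have h := trace_transpose_coupledVec_mul_self n l l hl (by omega)
  rw [show (coupledVec n l l).transpose = coupledVec n l l by
    rw [← (coupledVec_isDiag n l).diagonal_diag, Matrix.diagonal_transpose]] at h
  rw [coupledZero_eq, smul_mul_assoc, mul_smul_comm, smul_smul, Matrix.trace_smul, h, smul_eq_mul,
    ← Complex.ofReal_mul, ← sq, coupledFactor_sq, ← Complex.ofReal_natCast, ← Complex.ofReal_mul,
    ← Complex.ofReal_one]
  congr 1
  have h1 := Nat.factorial_mul_descFactorial (show l ≤ 2 * l by omega)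
  rw [show 2 * l - l = l by omega] at h1
  have h2 := Nat.choose_mul_factorial_mul_factorial (show 2 * l + 1 ≤ n + l + 1 by omega)
  rw [show n + l + 1 - (2 * l + 1) = n - l by omega, Nat.factorial_succ] at h2
  rw [h1]
  have h3 : ((n + l + 1).factorial : ℝ) ≠ 0 := by positivity
  have h4 : (l.factorial : ℝ) ≠ 0 := by positivity
  have h2' : ((n + l + 1).choose (2 * l + 1) : ℝ) * ((2 * l + 1) * (2 * l).factorial) *
    (n - l).factorial = (n + l + 1).factorial := by exact_mod_cast h2
  push_cast
  field_simp
  linear_combination h2'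

theorem trace_coupledZero_mul_of_ne {n l m : ℕ} (h : l ≠ m) :
    (coupledZero n l * coupledZero n m).trace = 0 :=
  trace_mul_eq_zero_of_casimir (casimir_coupledZero n l) (casimir_coupledZero n m)
    fun h' => h (casimir_eigenvalue_injective h')

/-! ### Polynomial functions on the sphere -/

namespace IsPolyOfDegreeLE

variable {n m : ℕ} {F G : S2 → ℂ}

theorem mono (h : IsPolyOfDegreeLE m F) (hmn : m ≤ n) : IsPolyOfDegreeLE n F := by
  obtain ⟨p, hp, hF⟩ := h
  exact ⟨p, hp.trans hmn, hF⟩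

theorem const (n : ℕ) (c : ℂ) : IsPolyOfDegreeLE n fun _ => c :=
  ⟨MvPolynomial.C c, by simp, by simp⟩

theorem coord (i : Fin 3) : IsPolyOfDegreeLE 1 fun x => (((x : E3) i : ℝ) : ℂ) :=
  ⟨MvPolynomial.X i, by simp, by simp⟩

theorem add (hF : IsPolyOfDegreeLE n F) (hG : IsPolyOfDegreeLE n G) :
    IsPolyOfDegreeLE n fun x => F x + G x := by
  obtain ⟨p, hp, hF⟩ := hF
  obtain ⟨q, hq, hG⟩ := hG
  exact ⟨p + q, (MvPolynomial.totalDegree_add p q).trans (max_le hp hq), by simp [hF, hG]⟩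

theorem mul (hF : IsPolyOfDegreeLE n F) (hG : IsPolyOfDegreeLE m G) :
    IsPolyOfDegreeLE (n + m) fun x => F x * G x := by
  obtain ⟨p, hp, hF⟩ := hF
  obtain ⟨q, hq, hG⟩ := hG
  exact ⟨p * q, (MvPolynomial.totalDegree_mul p q).trans (add_le_add hp hq), by simp [hF, hG]⟩

theorem const_mul (c : ℂ) (hF : IsPolyOfDegreeLE n F) : IsPolyOfDegreeLE n fun x => c * F x := by
  simpa using (const 0 c).mul hF

theorem sum {ι : Type*} {s : Finset ι} {F : ι → S2 → ℂ} (h : ∀ i ∈ s, IsPolyOfDegreeLE n (F i)) :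
    IsPolyOfDegreeLE n fun x => ∑ i ∈ s, F i x := by
  induction s using Finset.cons_induction with
  | empty => simpa using const n 0
  | cons a s ha ih =>
    simp only [Finset.sum_cons]
    exact (h a (by simp)).add (ih fun i hi => h i (by simp [hi]))

theorem contMDiff (hF : IsPolyOfDegreeLE n F) : ContMDiff (𝓡 2) 𝓘(ℝ, ℂ) ∞ F := by
  obtain ⟨p, -, hF⟩ := hF
  have h1 : ∀ p : MvPolynomial (Fin 3) ℂ,
      ContDiff ℝ ∞ fun v : E3 => MvPolynomial.eval (fun i => ((v i : ℝ) : ℂ)) p := by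
    intro p
    induction p using MvPolynomial.induction_on with
    | C a => simpa using contDiff_const
    | add p q hp hq => simpa using hp.add hq
    | mul_X p i hp =>
      simp only [map_mul, MvPolynomial.eval_X]
      exact hp.mul (Complex.ofRealCLM.contDiff.comp (EuclideanSpace.proj (𝕜 := ℝ) i).contDiff)
  have : Fact (Module.finrank ℝ E3 = 2 + 1) := ⟨by simp⟩
  have h2 : ContMDiff (𝓡 2) 𝓘(ℝ, E3) ∞ ((↑) : S2 → E3) := contMDiff_coe_sphere
  exact ((h1 p).contMDiff.comp h2).congr hF

end IsPolyOfDegreeLE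

/-! ### The operator-valued function of a diagonal matrix -/

theorem weightOp_eq_lieRep (n : ℕ) : weightOp n = lieRep n (pauli northPole) := by
  ext r s
  by_cases h : r = s
  · subst h
    simp [lieRep, pauli, northPole, weightOp]
    ring
  · simp [lieRep, pauli, northPole, weightOp, h]

theorem aeval_diagonal {n : ℕ} (d : Fin (n + 1) → ℂ) (f : Polynomial ℂ) :
    Polynomial.aeval (Matrix.diagonal d : Op n) f = Matrix.diagonal fun i => f.eval (d i) := by
  induction f using Polynomial.induction_on' with
  | add p q hp hq => simp [hp, hq]
  | monomial k a =>
    rw [Polynomial.aeval_monomial, Matrix.diagonal_pow, Algebra.algebraMap_eq_smul_one,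
      smul_mul_assoc, one_mul, ← Matrix.diagonal_smul]
    congr 1
    ext i
    simp

/-- Lagrange interpolation at the `n + 1` distinct eigenvalues of `2J₃`. The bound on the degree
becomes the degree bound on symbols. -/
theorem exists_aeval_weightOp {n : ℕ} {K : Op n} (hK : K.IsDiag) :
    ∃ f : Polynomial ℂ, f.natDegree ≤ n ∧ Polynomial.aeval (weightOp n) f = K := by
  have hinj : Set.InjOn (fun q : Fin (n + 1) => (n : ℂ) - 2 * (q : ℕ))
      (Finset.univ : Finset (Fin (n + 1))) := by
    intro r _ s _ h
    have h2 : ((r : ℕ) : ℂ) = ((s : ℕ) : ℂ) := by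
      have h' : (n : ℂ) - 2 * (r : ℕ) = n - 2 * (s : ℕ) := h
      linear_combination (-1 / 2) * h'
    exact Fin.ext (by exact_mod_cast h2)
  refine ⟨Lagrange.interpolate Finset.univ (fun q : Fin (n + 1) => (n : ℂ) - 2 * (q : ℕ)) K.diag,
    ?_, ?_⟩
  · have h := Lagrange.degree_interpolate_lt (r := K.diag) hinj
    rw [Finset.card_univ, Fintype.card_fin] at h
    exact Polynomial.natDegree_le_iff_coeff_eq_zero.mpr fun N hN =>
      (Polynomial.degree_lt_iff_coeff_zero _ _).mp h N hN
  · rw [weightOp, aeval_diagonal]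
    conv_rhs => rw [← hK.diagonal_diag]
    congr 1
    ext q
    exact Lagrange.eval_interpolate_at_node _ hinj (Finset.mem_univ q)

theorem aeval_actOp (n : ℕ) (g : SU2) (A : Op n) (f : Polynomial ℂ) :
    Polynomial.aeval (actOp n g A) f = actOp n g (Polynomial.aeval A f) :=
  Polynomial.aeval_algHom_apply
    (AlgHom.ofLinearMap (actLin n g) (actOp_one n g) (actOp_mul n g)) A f

theorem actOp_lieRep_pauli (n : ℕ) (g : SU2) (v : E3) :
    actOp n g (lieRep n (pauli v)) = lieRep n (pauli (rot g v)) := by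
  rw [actOp_lieRep, pauli_rot]
  rfl

/-- Conjugation commutes with `f` and turns `2J₃` into the spin component along `x`. The right side
involves no chosen rotation and is visibly polynomial in `x`. -/
theorem kernelAt_aeval (n : ℕ) (f : Polynomial ℂ) (x : S2) :
    kernelAt n (Polynomial.aeval (weightOp n) f) x =
      Polynomial.aeval (lieRep n (pauli x)) f := by
  rw [kernelAt, ← aeval_actOp, weightOp_eq_lieRep, actOp_lieRep_pauli]
  congr 4
  exact congrArg Subtype.val (Classical.choose_spec (exists_rotS_eq x))

theorem isPolyOfDegreeLE_lieRep_pauli_pow (n k : ℕ) (r s : Fin (n + 1)) :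
    IsPolyOfDegreeLE k fun x : S2 => (lieRep n (pauli x) ^ k) r s := by
  induction k generalizing s with
  | zero => exact IsPolyOfDegreeLE.const _ _
  | succ k ih =>
    simp only [pow_succ, Matrix.mul_apply]
    refine IsPolyOfDegreeLE.sum fun t _ => (ih t).mul ?_
    have h0 := IsPolyOfDegreeLE.coord 0
    have h1 := IsPolyOfDegreeLE.coord 1
    have h2 := IsPolyOfDegreeLE.coord 2
    simp only [lieRep, LinearMap.coe_mk, AddHom.coe_mk, Matrix.add_apply, Matrix.smul_apply, pauli,
      smul_eq_mul, mul_comm _ (Matrix.diagonal _ _ _), mul_comm _ (Jminus n _ _),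
      mul_comm _ (Jplus n _ _)]
    refine (((h2.const_mul _).add ?_).add ?_).add ?_
    · simpa using (h2.const_mul (-1)).const_mul _
    · simpa using (h0.add (h1.const_mul Complex.I)).const_mul _
    · simpa [sub_eq_add_neg] using (h0.add (h1.const_mul (-Complex.I))).const_mul _

theorem isPolyOfDegreeLE_kernelAt {n : ℕ} {K : Op n} (hK : K.IsDiag) (r s : Fin (n + 1)) :
    IsPolyOfDegreeLE n fun x => kernelAt n K x r s := by
  obtain ⟨f, hf, rfl⟩ := exists_aeval_weightOp hK
  simp only [kernelAt_aeval]
  simp only [Polynomial.aeval_eq_sum_range, Matrix.sum_apply, Matrix.smul_apply, smul_eq_mul]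
  refine IsPolyOfDegreeLE.sum fun k hk => ?_
  exact ((isPolyOfDegreeLE_lieRep_pauli_pow n k r s).mono
    ((Nat.lt_succ_iff.mp (Finset.mem_range.mp hk)).trans hf)).const_mul _

theorem lieRep_conjTranspose (n : ℕ) (X : Matrix (Fin 2) (Fin 2) ℂ) :
    (lieRep n X).conjTranspose = lieRep n X.conjTranspose := by
  have h1 : (Jminus n).conjTranspose = Jplus n := by
    change ((Jminus n).map (starRingEnd ℂ)).transpose = _
    rw [Jminus_map_conj, Jplus]
  have h2 : (Jplus n).conjTranspose = Jminus n := by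
    rw [← h1, Matrix.conjTranspose_conjTranspose]
  have h3 : (fun q : Fin (n + 1) => (n : ℂ) - (q : ℕ)) = star fun q : Fin (n + 1) =>
      (n : ℂ) - (q : ℕ) := by ext q; simp
  have h4 : (fun q : Fin (n + 1) => ((q : ℕ) : ℂ)) = star fun q : Fin (n + 1) =>
      ((q : ℕ) : ℂ) := by ext q; simp
  simp only [lieRep, LinearMap.coe_mk, AddHom.coe_mk, Matrix.conjTranspose_add,
    Matrix.conjTranspose_smul, h1, h2, Matrix.diagonal_conjTranspose, ← h3, ← h4,
    Matrix.conjTranspose_apply]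
  abel

theorem aeval_conjTranspose {n : ℕ} (A : Op n) (hA : A.conjTranspose = A) (f : Polynomial ℂ) :
    (Polynomial.aeval A f).conjTranspose = Polynomial.aeval A (f.map (starRingEnd ℂ)) := by
  induction f using Polynomial.induction_on' with
  | add p q hp hq => simp [hp, hq]
  | monomial k a =>
    simp [Polynomial.aeval_monomial, Matrix.conjTranspose_pow, hA, Algebra.algebraMap_eq_smul_one]

theorem kernelAt_conjTranspose {n : ℕ} {K : Op n} (hK : K.IsDiag) (x : S2) :
    (kernelAt n K x).conjTranspose = kernelAt n K.conjTranspose x := by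
  obtain ⟨f, -, rfl⟩ := exists_aeval_weightOp hK
  have h : ∀ y : S2, (lieRep n (pauli y)).conjTranspose = lieRep n (pauli y) := fun y => by
    rw [lieRep_conjTranspose, pauli_conjTranspose]
  rw [aeval_conjTranspose _ (by rw [weightOp_eq_lieRep, h]), kernelAt_aeval, kernelAt_aeval,
    aeval_conjTranspose _ (h x)]

theorem kernelAt_northPole {n : ℕ} {K : Op n} (hK : K.IsDiag) : kernelAt n K northPole = K := by
  obtain ⟨f, -, rfl⟩ := exists_aeval_weightOp hK
  rw [kernelAt_aeval, weightOp_eq_lieRep]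

theorem rotS_mul (g h : SU2) (x : S2) : rotS (g * h) x = rotS g (rotS h x) := by
  refine Subtype.ext (pauli_injective ?_)
  change pauli (rot (g * h) x) = pauli (rot g (rot h x))
  rw [pauli_rot, pauli_rot, pauliConj, pauliConj, pauli_rot, pauliConj, mul_inv_rev]
  simp only [Submonoid.coe_mul, mul_assoc]

theorem rotS_one (x : S2) : rotS 1 x = x := by
  refine Subtype.ext (pauli_injective ?_)
  change pauli (rot 1 x) = pauli x
  rw [pauli_rot, pauliConj]
  simp

theorem kernelAt_rotS_apply {n : ℕ} {K : Op n} (hK : K.IsDiag) (g : SU2) (x : S2) :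
    kernelAt n K (rotS g x) = actOp n g (kernelAt n K x) := by
  obtain ⟨h, rfl⟩ := exists_rotS_eq x
  rw [← rotS_mul, kernelAt_rotS n hK, kernelAt_rotS n hK, actOp_actOp]

theorem trace_kernelAt (n : ℕ) (K : Op n) (x : S2) : (kernelAt n K x).trace = K.trace :=
  trace_actOp n _ K

/-- `K ↦ K(𝐧)` as a linear map. -/
def kernelLin (n : ℕ) (x : S2) : Op n →ₗ[ℂ] Op n := actLin n (Classical.choose (exists_rotS_eq x))

theorem kernelLin_apply (n : ℕ) (x : S2) (K : Op n) : kernelLin n x K = kernelAt n K x := rfl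

theorem casimir_kernelAt (n : ℕ) (K : Op n) (x : S2) :
    casimir n (kernelAt n K x) = kernelAt n (casimir n K) x :=
  casimir_actOp n _ K

/-! ### The surface measure -/

theorem pauli_add (v w : E3) : pauli (v + w) = pauli v + pauli w := by
  ext i j
  fin_cases i <;> fin_cases j <;> simp [pauli] <;> ring

theorem pauli_smul (a : ℝ) (v : E3) : pauli (a • v) = (a : ℂ) • pauli v := by
  ext i j
  fin_cases i <;> fin_cases j <;> simp [pauli] <;> ring

theorem rot_smul (g : SU2) (a : ℝ) (v : E3) : rot g (a • v) = a • rot g v := by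
  apply pauli_injective
  rw [pauli_rot, pauli_smul, pauli_rot, pauliConj, pauliConj, pauli_smul, mul_smul_comm,
    smul_mul_assoc]

theorem rot_rot_inv (g : SU2) (v : E3) : rot g (rot g⁻¹ v) = v := by
  apply pauli_injective
  rw [pauli_rot, pauliConj, pauli_rot, pauliConj, inv_inv, ← mul_assoc, ← mul_assoc,
    SU2.mul_inv_coe, one_mul, mul_assoc, SU2.mul_inv_coe, mul_one]

/-- The rotation covered by `g` as a linear isometry. -/
def rotIso (g : SU2) : E3 ≃ₗᵢ[ℝ] E3 where
  toFun := rot g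
  invFun := rot g⁻¹
  map_add' v w := by
    apply pauli_injective
    rw [pauli_rot, pauli_add, pauli_rot, pauli_rot, pauliConj, pauliConj, pauliConj, pauli_add,
      mul_add, add_mul]
  map_smul' a v := rot_smul g a v
  left_inv v := by simpa using rot_rot_inv g⁻¹ v
  right_inv v := rot_rot_inv g v
  norm_map' v := norm_rot g v

theorem continuous_rotS (g : SU2) : Continuous (rotS g) :=
  ((rotIso g).continuous.comp continuous_subtype_val).subtype_mk _

/-- The action of `g` on the sphere as a homeomorphism. -/
def rotHomeo (g : SU2) : S2 ≃ₜ S2 where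
  toFun := rotS g
  invFun := rotS g⁻¹
  left_inv x := by rw [← rotS_mul, inv_mul_cancel, rotS_one]
  right_inv x := by rw [← rotS_mul, mul_inv_cancel, rotS_one]
  continuous_toFun := continuous_rotS g
  continuous_invFun := continuous_rotS g⁻¹

instance : IsFiniteMeasure surface := inferInstanceAs (IsFiniteMeasure (Measure.toSphere _))

/-- The surface measure of a set is a multiple of the volume of the cone over it, and a linear
isometry carries cones to cones and preserves volume. -/
theorem measurePreserving_rotS (g : SU2) : MeasurePreserving (rotS g) surface surface := by
  refine ⟨(continuous_rotS g).measurable, ?_⟩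
  ext s hs
  rw [Measure.map_apply (continuous_rotS g).measurable hs, surface,
    Measure.toSphere_apply' _ hs, Measure.toSphere_apply' _ ((continuous_rotS g).measurable hs)]
  congr 1
  rw [← (rotIso g).measurePreserving.measure_preimage_emb
    (rotIso g).toHomeomorph.measurableEmbedding (Set.Ioo (0 : ℝ) 1 • (Subtype.val '' s : Set E3))]
  congr 1
  ext v
  simp only [Set.mem_smul, Set.mem_preimage, Set.mem_image]
  constructor
  · rintro ⟨t, ht, _, ⟨y, hy, rfl⟩, rfl⟩
    exact ⟨t, ht, _, ⟨rotS g y, hy, rfl⟩, (rot_smul g t y).symm⟩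
  · rintro ⟨t, ht, _, ⟨y, hy, rfl⟩, h⟩
    refine ⟨t, ht, _, ⟨rotS g⁻¹ y, ?_, rfl⟩, (rotIso g).injective ?_⟩
    · rwa [← rotS_mul, mul_inv_cancel, rotS_one]
    · rw [← h]
      exact (rot_smul g t _).trans (congrArg (t • ·) (rot_rot_inv g y))

theorem integral_rotS (g : SU2) (F : S2 → ℂ) :
    ∫ x, F (rotS g x) ∂surface = ∫ x, F x ∂surface :=
  (measurePreserving_rotS g).integral_comp (rotHomeo g).measurableEmbedding F

theorem surface_real_univ : surface.real Set.univ = 4 * Real.pi := by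
  rw [surface, Measure.toSphere_real_apply_univ]
  rw [Measure.real, EuclideanSpace.volume_ball_fin_three]
  simp only [ENNReal.toReal_mul, finrank_euclideanSpace, Fintype.card_fin]
  simp only [one_pow, ENNReal.ofReal_one, ENNReal.toReal_one, one_mul]
  rw [ENNReal.toReal_ofReal (by positivity)]
  push_cast
  ring

theorem integral_surface_const (c : ℂ) : ∫ _, c ∂surface = 4 * (Real.pi : ℂ) * c := by
  rw [integral_const, surface_real_univ, Complex.real_smul]
  push_cast
  rfl

theorem IsPolyOfDegreeLE.continuous {n : ℕ} {F : S2 → ℂ} (hF : IsPolyOfDegreeLE n F) :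
    Continuous F :=
  hF.contMDiff.continuous

theorem integrable_surface {F : S2 → ℂ} (hF : Continuous F) : Integrable F surface := by
  have h := hF.continuousOn.integrableOn_compact (μ := surface) isCompact_univ
  rwa [integrableOn_univ] at h

theorem map_kernelIntegral {n : ℕ} {K : Op n} (hK : K.IsDiag) {F : S2 → ℂ} (hF : Continuous F)
    (φ : Op n →ₗ[ℂ] ℂ) :
    φ (kernelIntegral n K F) = ∫ x, F x * φ (kernelAt n K x) ∂surface := by
  have h1 : ∀ M : Op n, φ M = ∑ r, ∑ s, M r s * φ (Matrix.single r s 1) := by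
    intro M
    conv_lhs => rw [Matrix.matrix_eq_sum_single M]
    simp only [map_sum]
    refine Finset.sum_congr rfl fun r _ => Finset.sum_congr rfl fun s _ => ?_
    rw [← smul_eq_mul, ← map_smul, Matrix.smul_single, smul_eq_mul, mul_one]
  have h2 : ∀ r s, Integrable (fun x => F x * kernelAt n K x r s * φ (Matrix.single r s 1))
      surface := fun r s => integrable_surface
    ((hF.mul (isPolyOfDegreeLE_kernelAt hK r s).continuous).mul continuous_const)
  rw [h1]
  simp only [h1 (kernelAt n K _), Finset.mul_sum, ← mul_assoc]
  rw [integral_finsetSum _ fun r _ => integrable_finsetSum _ fun s _ => h2 r s]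
  refine Finset.sum_congr rfl fun r _ => ?_
  rw [integral_finsetSum _ fun s _ => h2 r s]
  refine Finset.sum_congr rfl fun s _ => ?_
  rw [integral_mul_const]
  rfl

/-! ### Schur's lemma -/

/-- An element of the maximal torus which generates a dense subgroup of it. -/
def torusElt : SU2 := SU2.mk' (Complex.exp Complex.I) 0 (by
  rw [← Complex.exp_conj, ← Complex.exp_add]
  simp)

theorem spinMatrix_of_diag (n : ℕ) (g : Matrix (Fin 2) (Fin 2) ℂ) (h01 : g 0 1 = 0)
    (h10 : g 1 0 = 0) :
    spinMatrix n g = Matrix.diagonal fun q : Fin (n + 1) =>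
      g 0 0 ^ (n - (q : ℕ)) * g 1 1 ^ (q : ℕ) := by
  ext r q
  by_cases hrq : r = q
  · subst hrq
    have hr : ((monoNorm n r : ℝ) : ℂ) ≠ 0 := by exact_mod_cast monoNorm_ne_zero n r
    simp only [spinMatrix, Matrix.of_apply, colPoly, h01, h10, map_zero, zero_mul, add_zero,
      zero_add, mul_pow, ← Polynomial.C_pow]
    rw [Polynomial.coeff_C_mul, Polynomial.coeff_C_mul, Polynomial.coeff_X_pow, if_pos rfl,
      Matrix.diagonal_apply_eq]
    simp [hr]
  · rw [spinMatrix_apply_of_diag n g h01 h10 hrq, Matrix.diagonal_apply_ne _ hrq]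

theorem actOp_torusElt (n : ℕ) (P : Op n) (r s : Fin (n + 1)) :
    actOp n torusElt P r s =
      Complex.exp (Complex.I * (2 * (((s : ℕ) : ℤ) - ((r : ℕ) : ℤ) : ℤ))) * P r s := by
  have e1 : (torusElt : Matrix (Fin 2) (Fin 2) ℂ) =
      !![Complex.exp Complex.I, 0; 0, Complex.exp (-Complex.I)] := by
    ext i j
    fin_cases i <;> fin_cases j <;> simp [torusElt, SU2.mk', ← Complex.exp_conj]
  have e2 : ((torusElt⁻¹ : SU2) : Matrix (Fin 2) (Fin 2) ℂ) =
      !![Complex.exp (-Complex.I), 0; 0, Complex.exp Complex.I] := by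
    rw [SU2.inv_coe, e1]
    ext i j
    fin_cases i <;> fin_cases j <;> simp [Matrix.conjTranspose_apply, ← Complex.exp_conj]
  change (spinMatrix n torusElt * P * spinMatrix n (torusElt⁻¹ : SU2)) r s = _
  rw [spinMatrix_of_diag n _ (by simp [e1]) (by simp [e1]),
    spinMatrix_of_diag n _ (by simp [e2]) (by simp [e2]), Matrix.mul_diagonal,
    Matrix.diagonal_mul, e1, e2]
  simp only [Matrix.of_apply, Matrix.cons_val_zero, Matrix.cons_val_one, ← Complex.exp_nat_mul]
  rw [mul_right_comm, ← Complex.exp_add, ← Complex.exp_add, ← Complex.exp_add]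
  congr 2
  have hr : (r : ℕ) ≤ n := Nat.lt_succ_iff.mp r.2
  have hs : (s : ℕ) ≤ n := Nat.lt_succ_iff.mp s.2
  push_cast [Nat.cast_sub hr, Nat.cast_sub hs]
  ring

/-- A coincidence with `a ≠ b` would make `π` rational. Thus `torusElt` alone distinguishes all
weights. -/
theorem exp_I_two_mul_int_injective {a b : ℤ}
    (h : Complex.exp (Complex.I * (2 * (a : ℤ))) = Complex.exp (Complex.I * (2 * (b : ℤ)))) :
    a = b := by
  obtain ⟨k, hk⟩ := Complex.exp_eq_exp_iff_exists_int.mp h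
  have h1 : (a : ℂ) = b + k * Real.pi := by
    have : Complex.I * (2 * ((a : ℂ) - b - k * Real.pi)) = 0 := by linear_combination hk
    have h2 := (mul_eq_zero.mp this).resolve_left Complex.I_ne_zero
    have h3 := (mul_eq_zero.mp h2).resolve_left two_ne_zero
    linear_combination h3
  have h2 : (a : ℝ) = b + k * Real.pi := by exact_mod_cast h1
  by_cases hk0 : k = 0
  · rw [hk0] at h2
    simp at h2
    exact_mod_cast h2
  · exfalso
    have hk0' : (k : ℝ) ≠ 0 := by exact_mod_cast hk0
    apply irrational_pi
    refine ⟨((a - b : ℤ) : ℚ) / k, ?_⟩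
    push_cast
    field_simp
    linarith

theorem rotS_torusElt_inv : rotS torusElt⁻¹ northPole = northPole := by
  refine Subtype.ext (pauli_injective ?_)
  change pauli (rot torusElt⁻¹ _) = _
  rw [pauli_rot, pauliConj, inv_inv]
  have h : ((torusElt⁻¹ : SU2) : Matrix (Fin 2) (Fin 2) ℂ) * pauli northPole =
      pauli northPole * ((torusElt⁻¹ : SU2) : Matrix (Fin 2) (Fin 2) ℂ) := by
    rw [SU2.inv_coe]
    ext i j
    fin_cases i <;> fin_cases j <;>
      simp [pauli, northPole, torusElt, SU2.mk', Matrix.mul_apply, Fin.sum_univ_two,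
        Matrix.conjTranspose_apply]
  rw [h, mul_assoc, SU2.inv_mul_coe, mul_one]

/-- The spectrum is simple, so an eigenvector has no other coordinate in the coupled basis. -/
theorem eq_smul_of_splitter {n : ℕ} {v : Op n} {i : CoupledIndex n}
    (h : splitter n v = splitValue n i • v) :
    v = (coupledBasis n).repr v i • coupledBasis n i := by
  have h1 : ∀ j, (coupledBasis n).repr (splitter n v) j =
      splitValue n j * (coupledBasis n).repr v j := by
    intro j
    have e : splitter n v = ∑ j, (splitValue n j * (coupledBasis n).repr v j) •
        coupledBasis n j := by
      conv_lhs => rw [← (coupledBasis n).sum_repr v, map_sum]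
      refine Finset.sum_congr rfl fun j _ => ?_
      rw [map_smul, coupledBasis_apply, splitter_coupledVec, smul_smul, mul_comm]
    rw [e, (coupledBasis n).repr_sum_self]
  have h2 : ∀ j, j ≠ i → (coupledBasis n).repr v j = 0 := by
    intro j hj
    have h3 := h1 j
    rw [h, map_smul, Finsupp.smul_apply, smul_eq_mul] at h3
    have h4 : (splitValue n i - splitValue n j) * (coupledBasis n).repr v j = 0 := by
      linear_combination h3
    exact (mul_eq_zero.mp h4).resolve_left
      (sub_ne_zero.mpr fun e => hj (splitValue_injective n e).symm)
  conv_lhs => rw [← (coupledBasis n).sum_repr v]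
  rw [Finset.sum_eq_single i]
  · intro j _ hj
    rw [h2 j hj, zero_smul]
  · simp

/-- Matrix units are eigenvectors of `torusElt`, and the eigenvalue determines the weight. Commuting
with this one element already forces `T` to preserve weight spaces. -/
theorem map_lie_weightOp {n : ℕ} {T : Op n →ₗ[ℂ] Op n} (hT : ∀ (g : SU2) (P : Op n),
    T (actOp n g P) = actOp n g (T P))
    (P : Op n) : T ⁅weightOp n, P⁆ = ⁅weightOp n, T P⁆ := by
  have h : T ∘ₗ LieAlgebra.ad ℂ (Op n) (weightOp n) =
      LieAlgebra.ad ℂ (Op n) (weightOp n) ∘ₗ T := by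
    refine (Matrix.stdBasis ℂ (Fin (n + 1)) (Fin (n + 1))).ext fun ⟨r, s⟩ => ?_
    rw [Matrix.stdBasis_eq_single]
    have e : ∀ r' s', T (Matrix.single r s 1) r' s' ≠ 0 →
        ((s : ℕ) : ℤ) - ((r : ℕ) : ℤ) = ((s' : ℕ) : ℤ) - ((r' : ℕ) : ℤ) := by
      intro r' s' h
      have h1 : actOp n torusElt (Matrix.single r s 1) = Complex.exp (Complex.I *
          (2 * (((s : ℕ) : ℤ) - ((r : ℕ) : ℤ) : ℤ))) • (Matrix.single r s 1 : Op n) := by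
        ext a b
        rw [actOp_torusElt, Matrix.smul_apply, smul_eq_mul, Matrix.single_apply]
        split_ifs with hab
        · rw [hab.1, hab.2]
        · simp
      have h2 := congrFun (congrFun (hT torusElt (Matrix.single r s 1)) r') s'
      rw [h1, map_smul, Matrix.smul_apply, smul_eq_mul, actOp_torusElt] at h2
      exact exp_I_two_mul_int_injective (mul_right_cancel₀ h h2)
    have h3 : ⁅weightOp n, (Matrix.single r s 1 : Op n)⁆ =
        (2 * ((s : ℕ) - (r : ℕ)) : ℂ) • (Matrix.single r s 1 : Op n) := by
      ext a b
      rw [weightOp, lie_diagonal_apply, Matrix.smul_apply, smul_eq_mul, Matrix.single_apply]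
      split_ifs with hab
      · rw [hab.1, hab.2]; ring
      · simp
    ext r' s'
    simp only [LinearMap.comp_apply, LieAlgebra.ad_apply]
    rw [h3, map_smul, Matrix.smul_apply, weightOp, lie_diagonal_apply, smul_eq_mul]
    by_cases h0 : T (Matrix.single r s 1) r' s' = 0
    · rw [h0]; simp
    · have h4 : ((s : ℕ) : ℂ) - ((r : ℕ) : ℂ) = ((s' : ℕ) : ℂ) - ((r' : ℕ) : ℂ) := by
        exact_mod_cast congrArg (Int.cast : ℤ → ℂ) (e r' s' h0)
      rw [h4]
      ring
  exact LinearMap.congr_fun h P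

/-- Every direction is a rotation of the north pole, where the claim is `map_lie_weightOp`. -/
theorem map_lie_lieRep_pauli {n : ℕ} {T : Op n →ₗ[ℂ] Op n} (hT : ∀ (g : SU2) (P : Op n),
    T (actOp n g P) = actOp n g (T P))
    (x : S2) (P : Op n) :
    T ⁅lieRep n (pauli x), P⁆ = ⁅lieRep n (pauli x), T P⁆ := by
  obtain ⟨g, rfl⟩ := exists_rotS_eq x
  have h1 : lieRep n (pauli (rotS g northPole : S2)) = actOp n g (weightOp n) := by
    rw [weightOp_eq_lieRep, actOp_lieRep_pauli]
    rfl
  have h2 : P = actOp n g (actOp n g⁻¹ P) := by rw [actOp_actOp, mul_inv_cancel, actOp_id]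
  rw [h1, h2, ← actOp_lie, hT, map_lie_weightOp hT, actOp_lie, ← hT g (actOp n g⁻¹ P)]

theorem map_lie_J {n : ℕ} {T : Op n →ₗ[ℂ] Op n} (hT : ∀ (g : SU2) (P : Op n),
    T (actOp n g P) = actOp n g (T P))
    (P : Op n) :
    T ⁅Jplus n, P⁆ = ⁅Jplus n, T P⁆ ∧ T ⁅Jminus n, P⁆ = ⁅Jminus n, T P⁆ := by
  -- The first two axes give `2J₁ = J₋ + J₊` and `2J₂ = i(J₋ - J₊)`, whose complex combinations
  -- recover `J₊` and `J₋`.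
  let x : S2 := ⟨!₂[1, 0, 0], by simp [EuclideanSpace.norm_eq, Fin.sum_univ_three]⟩
  let y : S2 := ⟨!₂[0, 1, 0], by simp [EuclideanSpace.norm_eq, Fin.sum_univ_three]⟩
  have hx : lieRep n (pauli x) = Jminus n + Jplus n := by
    simp [lieRep, pauli, x]
  have hy : lieRep n (pauli y) = Complex.I • (Jminus n - Jplus n) := by
    simp [lieRep, pauli, y, sub_eq_add_neg]
  have h1 : Jplus n = (1 / 2 : ℂ) • (lieRep n (pauli x) + Complex.I • lieRep n (pauli y)) := by
    rw [hx, hy, smul_smul, Complex.I_mul_I]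
    module
  have h2 : Jminus n = (1 / 2 : ℂ) • (lieRep n (pauli x) - Complex.I • lieRep n (pauli y)) := by
    rw [hx, hy, smul_smul, Complex.I_mul_I]
    module
  constructor
  · rw [h1, smul_lie, add_lie, smul_lie, map_smul, map_add, map_smul, map_lie_lieRep_pauli hT,
      map_lie_lieRep_pauli hT, smul_lie, add_lie, smul_lie]
  · rw [h2, smul_lie, sub_lie, smul_lie, map_smul, map_sub, map_smul, map_lie_lieRep_pauli hT,
      map_lie_lieRep_pauli hT, smul_lie, sub_lie, smul_lie]

theorem map_splitter {n : ℕ} {T : Op n →ₗ[ℂ] Op n} (hT : ∀ (g : SU2) (P : Op n),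
    T (actOp n g P) = actOp n g (T P))
    (P : Op n) : T (splitter n P) = splitter n (T P) := by
  simp only [splitter, LinearMap.add_apply, casimir_eq, LieAlgebra.ad_apply, map_add, map_smul,
    map_lie_weightOp hT, (map_lie_J hT _).1, (map_lie_J hT _).2]

/-- Schur's lemma for the operator space. -/
theorem exists_scalar_of_commute {n : ℕ} {T : Op n →ₗ[ℂ] Op n} (hT : ∀ (g : SU2) (P : Op n),
    T (actOp n g P) = actOp n g (T P)) :
    ∃ τ : Fin (n + 1) → ℂ, ∀ (l : Fin (n + 1)) (k : ℕ),
    T (coupledVec n l k) = τ l • coupledVec n l k := by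
  -- The scalar is read off on the highest weight vector `J₊^l` and carried down the block by
  -- `ad(J₋)`.
  refine ⟨fun l => (coupledBasis n).repr (T (coupledVec n l 0)) ⟨l, 0⟩, fun l k => ?_⟩
  induction k with
  | zero =>
    have h := eq_smul_of_splitter (n := n) (v := T (coupledVec n l 0)) (i := ⟨l, 0⟩) (by
      rw [← map_splitter hT, ← map_smul]
      exact congrArg T (splitter_coupledVec n ⟨l, 0⟩))
    conv_lhs => rw [h]
    rw [coupledBasis_apply]
    rfl
  | succ k ih => rw [← lie_Jminus_coupledVec, (map_lie_J hT _).2, ih, lie_smul]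

theorem trace_of_scalars {n : ℕ} {T : Op n →ₗ[ℂ] Op n} {τ : Fin (n + 1) → ℂ}
    (h : ∀ (l : Fin (n + 1)) (k : ℕ), T (coupledVec n l k) = τ l • coupledVec n l k) :
    LinearMap.trace ℂ (Op n) T = ∑ l : Fin (n + 1), (2 * (l : ℕ) + 1) * τ l := by
  rw [LinearMap.trace_eq_matrix_trace ℂ (coupledBasis n), Matrix.trace, Fintype.sum_sigma]
  refine Finset.sum_congr rfl fun l _ => ?_
  have : ∀ k : Fin (2 * (l : ℕ) + 1), (LinearMap.toMatrix (coupledBasis n) (coupledBasis n)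
      T).diag ⟨l, k⟩ = τ l := by
    intro k
    rw [Matrix.diag_apply, LinearMap.toMatrix_apply, coupledBasis_apply, h, map_smul]
    simp only
    rw [← coupledBasis_apply n ⟨l, k⟩]
    simp
  simp only [this]
  simp

theorem trace_eq_sum_entries {n : ℕ} (T : Op n →ₗ[ℂ] Op n) :
    LinearMap.trace ℂ (Op n) T = ∑ r, ∑ s, T (Matrix.single r s 1) r s := by
  rw [LinearMap.trace_eq_matrix_trace ℂ (Matrix.stdBasis ℂ (Fin (n + 1)) (Fin (n + 1))),
    Matrix.trace, Fintype.sum_prod_type]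
  refine Finset.sum_congr rfl fun r _ => Finset.sum_congr rfl fun s _ => ?_
  rw [Matrix.diag_apply, LinearMap.toMatrix_apply, Matrix.stdBasis_eq_single]
  rfl

/-! ### Integrating a covariant symbol against an operator kernel -/

theorem isPolyOfDegreeLE_covariantSymbol {n : ℕ} {K : Op n} (hK : K.IsDiag) (P : Op n) :
    IsPolyOfDegreeLE n (covariantSymbol n K P) := by
  change IsPolyOfDegreeLE n fun x => ∑ r, (P * kernelAt n K x) r r
  refine IsPolyOfDegreeLE.sum fun r _ => ?_
  simp only [Matrix.mul_apply]
  exact IsPolyOfDegreeLE.sum fun s _ => (isPolyOfDegreeLE_kernelAt hK s r).const_mul _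

theorem isLinearMap_covariantSymbol (n : ℕ) (K : Op n) : IsLinearMap ℂ (covariantSymbol n K) where
  map_add P Q := by ext x; simp [covariantSymbol, add_mul]
  map_smul a P := by ext x; simp [covariantSymbol]

theorem covariantSymbol_actOp {n : ℕ} {K : Op n} (hK : K.IsDiag) (g : SU2) (P : Op n) (x : S2) :
    covariantSymbol n K (actOp n g P) x = covariantSymbol n K P (rotS g⁻¹ x) := by
  rw [covariantSymbol, covariantSymbol, kernelAt_rotS_apply hK, trace_actOp_mul]

theorem covariantSymbol_conjTranspose {n : ℕ} {K : Op n} (hK : K.IsDiag)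
    (hK' : K.conjTranspose = K) (P : Op n) (x : S2) :
    covariantSymbol n K P.conjTranspose x = (starRingEnd ℂ) (covariantSymbol n K P x) := by
  rw [covariantSymbol, covariantSymbol, starRingEnd_apply, ← Matrix.trace_conjTranspose,
    Matrix.conjTranspose_mul, kernelAt_conjTranspose hK, hK', Matrix.trace_mul_comm]

theorem trace_mul_kernelIntegral {n : ℕ} {K : Op n} (hK : K.IsDiag) {F : S2 → ℂ}
    (hF : Continuous F) (P : Op n) :
    (P * kernelIntegral n K F).trace = ∫ x, F x * covariantSymbol n K P x ∂surface :=
  map_kernelIntegral hK hF (Matrix.traceLinearMap _ ℂ ℂ ∘ₗ LinearMap.mulLeft ℂ P)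

/-- The map `P ↦ ∫ trace (P A(𝐧)) B(𝐧) dS`. -/
def pairMap (n : ℕ) {A B : Op n} (hA : A.IsDiag) (hB : B.IsDiag) : Op n →ₗ[ℂ] Op n where
  toFun P := kernelIntegral n B (covariantSymbol n A P)
  map_add' P Q := by
    ext r s
    have h : ∀ P : Op n, Integrable (fun x => covariantSymbol n A P x * kernelAt n B x r s)
        surface := fun P => integrable_surface
      ((isPolyOfDegreeLE_covariantSymbol hA P).continuous.mul
        (isPolyOfDegreeLE_kernelAt hB r s).continuous)
    simp only [kernelIntegral, Matrix.add_apply, Matrix.of_apply,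
      (isLinearMap_covariantSymbol n A).map_add, Pi.add_apply, add_mul]
    exact integral_add (h P) (h Q)
  map_smul' a P := by
    ext r s
    simp only [kernelIntegral, Matrix.smul_apply, Matrix.of_apply,
      (isLinearMap_covariantSymbol n A).map_smul, Pi.smul_apply, smul_eq_mul, mul_assoc,
      RingHom.id_apply]
    exact integral_const_mul _ _

section PairMap

variable {n : ℕ} {A B : Op n} (hA : A.IsDiag) (hB : B.IsDiag)

theorem pairMap_apply (P : Op n) :
    pairMap n hA hB P = kernelIntegral n B (covariantSymbol n A P) := rfl

/-- Substitute `x ↦ g x` in the integral; both factors are equivariant and the measure is invariant.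
-/
theorem pairMap_actOp (g : SU2) (P : Op n) :
    pairMap n hA hB (actOp n g P) = actOp n g (pairMap n hA hB P) := by
  ext r s
  have h := map_kernelIntegral hB (isPolyOfDegreeLE_covariantSymbol hA P).continuous
    (Matrix.entryLinearMap ℂ ℂ r s ∘ₗ actLin n g)
  simp only [LinearMap.comp_apply, actLin_apply, Matrix.entryLinearMap_apply] at h
  rw [pairMap_apply, pairMap_apply, h]
  change ∫ x, covariantSymbol n A (actOp n g P) x * kernelAt n B x r s ∂surface = _
  rw [← integral_rotS g]
  refine integral_congr_ae (Filter.Eventually.of_forall fun x => ?_)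
  simp only
  rw [covariantSymbol_actOp hA, ← rotS_mul, inv_mul_cancel, rotS_one, kernelAt_rotS_apply hB]

/-- At each point the integrand `P ↦ trace(P A(𝐧)) B(𝐧)` has trace `trace(A(𝐧) B(𝐧))`. Both kernels
are conjugated by the same rotation, so this is the constant `trace(AB)`, integrated over total mass
`4π`. -/
theorem trace_pairMap :
    LinearMap.trace ℂ (Op n) (pairMap n hA hB) = 4 * (Real.pi : ℂ) * (A * B).trace := by
  rw [trace_eq_sum_entries, ← integral_surface_const]
  have h1 : ∀ x, (A * B).trace = ∑ r, ∑ s, covariantSymbol n A (Matrix.single r s 1) x *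
      kernelAt n B x r s := by
    intro x
    have h2 : (A * B).trace = (kernelAt n A x * kernelAt n B x).trace := by
      rw [kernelAt, kernelAt, ← actOp_mul, trace_actOp]
    rw [h2, Matrix.trace_mul_comm, Matrix.trace]
    refine Finset.sum_congr rfl fun r _ => ?_
    rw [Matrix.diag_apply, Matrix.mul_apply]
    refine Finset.sum_congr rfl fun s _ => ?_
    rw [covariantSymbol, Matrix.trace_single_mul, mul_comm]
    simp
  have h3 : ∀ r s, Integrable (fun x => covariantSymbol n A (Matrix.single r s 1) x *
      kernelAt n B x r s) surface := fun r s => integrable_surface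
    ((isPolyOfDegreeLE_covariantSymbol hA _).continuous.mul
      (isPolyOfDegreeLE_kernelAt hB r s).continuous)
  rw [integral_congr_ae (Filter.Eventually.of_forall h1),
    integral_finsetSum _ fun r _ => integrable_finsetSum _ fun s _ => h3 r s]
  refine Finset.sum_congr rfl fun r _ => ?_
  rw [integral_finsetSum _ fun s _ => h3 r s]
  rfl

end PairMap

/-! ### Characteristic numbers -/

/-- The coefficient of `e^j(l, 0)` in `charKernel n c`. -/
def charCoef (n : ℕ) (c : Fin n → ℝ) (l : Fin (n + 1)) : ℝ :=
  (Fin.cons 1 c : Fin (n + 1) → ℝ) l * Real.sqrt ((2 * ((l : ℕ) : ℝ) + 1) / ((n : ℝ) + 1))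

/-- Since `e^j(0,0) = I/√(n+1)`, the term `I/(n+1)` is the summand `l = 0` with characteristic
number `1`. -/
theorem charKernel_eq (n : ℕ) (c : Fin n → ℝ) :
    charKernel n c = ∑ l : Fin (n + 1), ((charCoef n c l : ℝ) : ℂ) • coupledZero n l := by
  rw [Fin.sum_univ_succ, charKernel]
  congr 1
  · have h1 : coupledZero n 0 = ((Real.sqrt (1 / ((n : ℝ) + 1)) : ℝ) : ℂ) • (1 : Op n) := by
      rw [coupledZero_eq, coupledFactor]
      have e : ((n - 0).factorial : ℝ) / ((n + 0 + 1).factorial : ℝ) = 1 / ((n : ℝ) + 1) := by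
        rw [Nat.sub_zero, Nat.add_zero, Nat.factorial_succ]
        have : (n.factorial : ℝ) ≠ 0 := by positivity
        push_cast
        field_simp
      rw [e]
      simp [coupledVec]
    have h2 : charCoef n c 0 = Real.sqrt (1 / ((n : ℝ) + 1)) := by simp [charCoef]
    rw [Fin.val_zero, h1, h2, smul_smul, ← Complex.ofReal_mul,
      Real.mul_self_sqrt (by positivity)]
    push_cast
    rfl
  · refine Finset.sum_congr rfl fun i _ => ?_
    simp [charCoef]

theorem charKernel_isDiag (n : ℕ) (c : Fin n → ℝ) : (charKernel n c).IsDiag := by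
  intro r s hrs
  rw [charKernel_eq, Matrix.sum_apply]
  refine Finset.sum_eq_zero fun l _ => ?_
  rw [Matrix.smul_apply, coupledZero_isDiag n l hrs, smul_zero]

theorem charKernel_conjTranspose (n : ℕ) (c : Fin n → ℝ) :
    (charKernel n c).conjTranspose = charKernel n c := by
  rw [charKernel_eq, Matrix.conjTranspose_sum]
  refine Finset.sum_congr rfl fun l _ => ?_
  rw [Matrix.conjTranspose_smul, coupledZero_conjTranspose]
  congr 1
  exact Complex.conj_ofReal _

theorem trace_coupledZero_mul_charKernel (n : ℕ) (c : Fin n → ℝ) (l : Fin (n + 1)) :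
    (coupledZero n l * charKernel n c).trace = (charCoef n c l : ℝ) := by
  rw [charKernel_eq, Finset.mul_sum, Matrix.trace_sum, Finset.sum_eq_single l]
  · rw [mul_smul_comm, Matrix.trace_smul, trace_coupledZero_mul_self (Nat.lt_succ_iff.mp l.2),
      smul_eq_mul, mul_one]
  · intro m _ hm
    rw [mul_smul_comm, Matrix.trace_smul,
      trace_coupledZero_mul_of_ne fun h => hm (Fin.ext h.symm), smul_zero]
  · simp

theorem trace_charKernel (n : ℕ) (c : Fin n → ℝ) : (charKernel n c).trace = 1 := by
  have h1 : ∀ l : Fin n, (coupledZero n (l + 1)).trace = 0 := by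
    intro l
    -- The trace is the pairing with the identity, which has Casimir eigenvalue `0`.
    have h := trace_mul_eq_zero_of_casimir (casimir_coupledZero n (l + 1))
      (Q := 1) (b := 0) (by simp [casimir_eq, Ring.lie_def]) (by
        push_cast
        norm_cast)
    rwa [mul_one] at h
  rw [charKernel, Matrix.trace_add, Matrix.trace_sum, Finset.sum_eq_zero]
  · have : (n : ℂ) + 1 ≠ 0 := by exact_mod_cast Nat.succ_ne_zero n
    simp [this]
  · intro l _
    rw [Matrix.trace_smul, h1, smul_zero]

/-- Rotation preserves Casimir eigenvalues, so an operator in block `l` pairs to zero with every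
component of `K(𝐧)` but the `l`-th. -/
theorem covariantSymbol_charKernel (n : ℕ) (c : Fin n → ℝ) (l : Fin (n + 1)) (k : ℕ) (x : S2) :
    covariantSymbol n (charKernel n c) (coupledVec n l k) x =
      (charCoef n c l : ℝ) * covariantSymbol n (coupledZero n l) (coupledVec n l k) x := by
  rw [covariantSymbol, ← kernelLin_apply, charKernel_eq, map_sum, Finset.mul_sum,
    Matrix.trace_sum, Finset.sum_eq_single l]
  · rw [map_smul, mul_smul_comm, Matrix.trace_smul]
    rfl
  · intro m _ hm
    rw [map_smul, mul_smul_comm, Matrix.trace_smul, kernelLin_apply,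
      trace_mul_eq_zero_of_casimir (casimir_coupledVec n l k) (b := 2 * (m : ℕ) * ((m : ℕ) + 1)),
      smul_zero]
    · rw [casimir_kernelAt, casimir_coupledZero, ← kernelLin_apply, map_smul, kernelLin_apply]
    · exact fun h => hm (Fin.ext (casimir_eigenvalue_injective h).symm)
  · simp

theorem covariantSymbol_coupledZero_of_ne {n : ℕ} {l m : ℕ} (h : m ≠ l) (k : ℕ) (x : S2) :
    covariantSymbol n (coupledZero n l) (coupledVec n m k) x = 0 :=
  trace_mul_eq_zero_of_casimir (casimir_coupledVec n m k)
    (by rw [casimir_kernelAt, casimir_coupledZero, ← kernelLin_apply, map_smul, kernelLin_apply])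
    fun e => h (casimir_eigenvalue_injective e)

/-- The map kills all blocks but the `l`-th, so its trace is `2l + 1` times the one remaining Schur
scalar. -/
theorem pairMap_coupledZero_charKernel (n : ℕ) (c : Fin n → ℝ) (l : Fin (n + 1)) (k : ℕ) :
    pairMap n (coupledZero_isDiag n l) (charKernel_isDiag n c) (coupledVec n l k) =
      (4 * (Real.pi : ℂ) * (charCoef n c l : ℝ) / (2 * (l : ℕ) + 1)) • coupledVec n l k := by
  obtain ⟨τ, hτ⟩ := exists_scalar_of_commute
    (pairMap_actOp (coupledZero_isDiag n l) (charKernel_isDiag n c))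
  have h0 : ∀ m, m ≠ l → τ m = 0 := by
    intro m hm
    have h1 := hτ m 0
    rw [pairMap_apply] at h1
    have h2 : kernelIntegral n (charKernel n c)
        (covariantSymbol n (coupledZero n l) (coupledVec n m 0)) = 0 := by
      ext r s
      simp only [kernelIntegral, Matrix.of_apply,
        covariantSymbol_coupledZero_of_ne fun e => hm (Fin.ext e)]
      simp
    rw [h2, eq_comm, smul_eq_zero] at h1
    exact h1.resolve_right (coupledVec_ne_zero (Nat.lt_succ_iff.mp m.2) (Nat.zero_le _))
  have h1 := trace_of_scalars hτ
  rw [trace_pairMap, trace_coupledZero_mul_charKernel, Finset.sum_eq_single l] at h1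
  · have h2 : (2 * ((l : ℕ) : ℂ) + 1) ≠ 0 := by exact_mod_cast Nat.succ_ne_zero (2 * (l : ℕ))
    rw [hτ, h1, mul_div_cancel_left₀ _ h2]
  · intro m _ hm
    rw [h0 m hm, mul_zero]
  · simp

theorem charCoef_mul_charCoef_inv {n : ℕ} {c : Fin n → ℝ} (hc : ∀ l, c l ≠ 0) (l : Fin (n + 1)) :
    charCoef n c l * charCoef n (fun i => 1 / c i) l = (2 * ((l : ℕ) : ℝ) + 1) / ((n : ℝ) + 1) := by
  have h1 : (Fin.cons 1 c : Fin (n + 1) → ℝ) l *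
      (Fin.cons 1 (fun i => 1 / c i) : Fin (n + 1) → ℝ) l = 1 := by
    refine Fin.cases ?_ (fun i => ?_) l
    · simp
    · simp [hc i]
  have h2 := Real.mul_self_sqrt (show (0 : ℝ) ≤ (2 * ((l : ℕ) : ℝ) + 1) / ((n : ℝ) + 1) by
    positivity)
  rw [charCoef, charCoef]
  linear_combination (Real.sqrt ((2 * ((l : ℕ) : ℝ) + 1) / ((n : ℝ) + 1))) ^ 2 * h1 + h2

theorem charKernel_reconstruction {n : ℕ} {c : Fin n → ℝ} (hc : ∀ l, c l ≠ 0) (P : Op n) :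
    P = (((n : ℂ) + 1) / (4 * (Real.pi : ℂ))) • kernelIntegral n (charKernel n fun l => 1 / c l)
      (covariantSymbol n (charKernel n c) P) := by
  have h : LinearMap.id = (((n : ℂ) + 1) / (4 * (Real.pi : ℂ))) • pairMap n (charKernel_isDiag n c)
      (charKernel_isDiag n fun l => 1 / c l) := by
    refine (coupledBasis n).ext fun ⟨l, k⟩ => ?_
    rw [coupledBasis_apply]
    simp only [LinearMap.id_apply, LinearMap.smul_apply]
    have h1 : pairMap n (charKernel_isDiag n c) (charKernel_isDiag n fun l => 1 / c l)
        (coupledVec n l k) = ((charCoef n c l : ℝ) : ℂ) • pairMap n (coupledZero_isDiag n l)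
          (charKernel_isDiag n fun l => 1 / c l) (coupledVec n l k) := by
      ext r s
      rw [Matrix.smul_apply, pairMap_apply, pairMap_apply]
      simp only [kernelIntegral, Matrix.of_apply, covariantSymbol_charKernel, mul_assoc,
        smul_eq_mul]
      exact integral_const_mul _ _
    rw [h1, pairMap_coupledZero_charKernel, smul_smul, smul_smul]
    have h2 : (((charCoef n c l : ℝ) : ℂ)) * ((charCoef n (fun i => 1 / c i) l : ℝ) : ℂ) =
        (2 * ((l : ℕ) : ℂ) + 1) / ((n : ℂ) + 1) := by
      rw [← Complex.ofReal_mul, charCoef_mul_charCoef_inv hc]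
      push_cast
      rfl
    have h3 : (2 * ((l : ℕ) : ℂ) + 1) ≠ 0 := by exact_mod_cast Nat.succ_ne_zero (2 * (l : ℕ))
    have h4 : (n : ℂ) + 1 ≠ 0 := by exact_mod_cast Nat.succ_ne_zero n
    have h5 : (Real.pi : ℂ) ≠ 0 := by exact_mod_cast Real.pi_ne_zero
    have h6 : ((n : ℂ) + 1) / (4 * (Real.pi : ℂ)) * ((charCoef n c l : ℝ) *
        (4 * (Real.pi : ℂ) * ((charCoef n (fun i => 1 / c i) l : ℝ) : ℂ) /
          (2 * ((l : ℕ) : ℂ) + 1))) = 1 := by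
      field_simp at h2 ⊢
      linear_combination h2
    rw [mul_assoc, h6, one_smul]
  exact LinearMap.congr_fun h P

theorem charKernel_injective {n : ℕ} {c c' : Fin n → ℝ} (h : charKernel n c = charKernel n c') :
    c = c' := by
  ext i
  have h1 := trace_coupledZero_mul_charKernel n c i.succ
  rw [h, trace_coupledZero_mul_charKernel, Complex.ofReal_inj] at h1
  simp only [charCoef, Fin.cons_succ] at h1
  refine (mul_right_cancel₀ (Real.sqrt_ne_zero'.mpr ?_) h1).symm
  positivity

/-- At the north pole the symbol is the functional `P ↦ trace(PK)`, which determines `K`. -/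
theorem covariantSymbol_injective {n : ℕ} {K K' : Op n} (hK : K.IsDiag) (hK' : K'.IsDiag)
    (h : covariantSymbol n K = covariantSymbol n K') : K = K' := by
  refine Matrix.ext_iff_trace_mul_left.mpr fun P => ?_
  have h1 := congrFun (congrFun h P) northPole
  rwa [covariantSymbol, covariantSymbol, kernelAt_northPole hK, kernelAt_northPole hK'] at h1

theorem isOperatorKernel_charKernel {n : ℕ} {c : Fin n → ℝ} (hc : ∀ l, c l ≠ 0) :
    IsOperatorKernel n (charKernel n c) := by
  have hK := charKernel_isDiag n c
  refine ⟨hK, fun P => (isPolyOfDegreeLE_covariantSymbol hK P).contMDiff,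
    isLinearMap_covariantSymbol n _, fun P Q h => ?_, fun g P x => covariantSymbol_actOp hK g P x,
    covariantSymbol_conjTranspose hK (charKernel_conjTranspose n c), fun P => ?_⟩
  · rw [charKernel_reconstruction hc P, charKernel_reconstruction hc Q, h]
  -- Normalization is the trace of the reconstruction formula, because `K_{1/c}(𝐧)` has trace one
  -- everywhere.
  · have h := congrArg (fun M => (1 * M).trace) (charKernel_reconstruction hc P)
    simp only [mul_smul_comm, Matrix.trace_smul] at h
    rw [trace_mul_kernelIntegral (charKernel_isDiag n _)
      (isPolyOfDegreeLE_covariantSymbol hK P).continuous, one_mul] at h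
    simp only [covariantSymbol, one_mul, trace_kernelAt, trace_charKernel, mul_one] at h
    rw [h]
    have h4 : (n : ℂ) + 1 ≠ 0 := by exact_mod_cast Nat.succ_ne_zero n
    simp only [covariantSymbol, smul_eq_mul]
    field_simp

/-! ### The dimension of the space of polynomial functions -/

/-- A spanning family of the space of polynomial functions of degree `≤ n` on the sphere. -/
def polyFamily (n : ℕ) (p : Fin (n + 1) × Fin (n + 1)) (x : S2) : ℂ :=
  -- Pairs `(a, b)` on or below the antidiagonal encode `x^a y^b`; the others encode `x^(n-a)
  -- y^(n-b) z`, where `(n-a) + (n-b) < n`. Together they fill a square of exactly `(n+1)²` indices.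
  if (p.1 : ℕ) + p.2 ≤ n then
    (((x : E3) 0 : ℝ) : ℂ) ^ (p.1 : ℕ) * (((x : E3) 1 : ℝ) : ℂ) ^ (p.2 : ℕ)
  else (((x : E3) 0 : ℝ) : ℂ) ^ (n - (p.1 : ℕ)) * (((x : E3) 1 : ℝ) : ℂ) ^ (n - (p.2 : ℕ)) *
    (((x : E3) 2 : ℝ) : ℂ)

theorem sum_sq_eq_one (x : S2) : (((x : E3) 0 : ℝ) : ℂ) ^ 2 + (((x : E3) 1 : ℝ) : ℂ) ^ 2 +
    (((x : E3) 2 : ℝ) : ℂ) ^ 2 = 1 := by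
  have h1 : ‖(x : E3)‖ ^ 2 = 1 := by rw [norm_eq_of_mem_sphere]; norm_num
  rw [EuclideanSpace.norm_sq_eq, Fin.sum_univ_three] at h1
  simp only [Real.norm_eq_abs, sq_abs] at h1
  exact_mod_cast h1

/-- The relation `z² = 1 - x² - y²` lowers the exponent of `z` by two without raising the total
degree, until it is `0` or `1`. -/
theorem monomial_mem_span (n c : ℕ) : ∀ a b : ℕ, a + b + c ≤ n →
    (fun x : S2 => (((x : E3) 0 : ℝ) : ℂ) ^ a * (((x : E3) 1 : ℝ) : ℂ) ^ b *
      (((x : E3) 2 : ℝ) : ℂ) ^ c) ∈ Submodule.span ℂ (Set.range (polyFamily n)) := by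
  induction c using Nat.strong_induction_on with
  | _ c ih =>
  intro a b h
  rcases c with _ | _ | c
  · refine Submodule.subset_span ⟨(⟨a, by omega⟩, ⟨b, by omega⟩), ?_⟩
    ext x
    simp only [polyFamily]
    rw [if_pos (by omega), pow_zero, mul_one]
  · refine Submodule.subset_span ⟨(⟨n - a, by omega⟩, ⟨n - b, by omega⟩), ?_⟩
    ext x
    simp only [polyFamily]
    rw [if_neg (by omega), zero_add, pow_one, show n - (n - a) = a by omega,
      show n - (n - b) = b by omega]
  · have e : (fun x : S2 => (((x : E3) 0 : ℝ) : ℂ) ^ a * (((x : E3) 1 : ℝ) : ℂ) ^ b *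
        (((x : E3) 2 : ℝ) : ℂ) ^ (c + 1 + 1)) =
        (fun x : S2 => (((x : E3) 0 : ℝ) : ℂ) ^ a * (((x : E3) 1 : ℝ) : ℂ) ^ b *
          (((x : E3) 2 : ℝ) : ℂ) ^ c) -
        (fun x : S2 => (((x : E3) 0 : ℝ) : ℂ) ^ (a + 2) * (((x : E3) 1 : ℝ) : ℂ) ^ b *
          (((x : E3) 2 : ℝ) : ℂ) ^ c) -
        (fun x : S2 => (((x : E3) 0 : ℝ) : ℂ) ^ a * (((x : E3) 1 : ℝ) : ℂ) ^ (b + 2) *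
          (((x : E3) 2 : ℝ) : ℂ) ^ c) := by
      ext x
      simp only [Pi.sub_apply]
      linear_combination (((x : E3) 0 : ℝ) : ℂ) ^ a * (((x : E3) 1 : ℝ) : ℂ) ^ b *
        (((x : E3) 2 : ℝ) : ℂ) ^ c * sum_sq_eq_one x
    rw [e]
    exact Submodule.sub_mem _ (Submodule.sub_mem _ (ih c (by omega) a b (by omega))
      (ih c (by omega) (a + 2) b (by omega))) (ih c (by omega) a (b + 2) (by omega))

theorem IsPolyOfDegreeLE.mem_span {n : ℕ} {F : S2 → ℂ} (hF : IsPolyOfDegreeLE n F) :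
    F ∈ Submodule.span ℂ (Set.range (polyFamily n)) := by
  obtain ⟨p, hp, hF⟩ := hF
  have e : F = ∑ d ∈ p.support, p.coeff d • fun x : S2 => (((x : E3) 0 : ℝ) : ℂ) ^ (d 0) *
      (((x : E3) 1 : ℝ) : ℂ) ^ (d 1) * (((x : E3) 2 : ℝ) : ℂ) ^ (d 2) := by
    ext x
    rw [hF, MvPolynomial.eval_eq', Finset.sum_apply]
    simp only [Fin.prod_univ_three, Pi.smul_apply, smul_eq_mul]
  rw [e]
  refine Submodule.sum_mem _ fun d hd => Submodule.smul_mem _ _ (monomial_mem_span n _ _ _ ?_)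
  have h1 := (MvPolynomial.le_totalDegree hd).trans hp
  rwa [Finsupp.sum_fintype _ _ (fun _ => rfl), Fin.sum_univ_three] at h1

/-- The image has dimension `(n+1)²` and lies in a span of at most that dimension, so the two
coincide. -/
theorem exists_symbol_eq {n : ℕ} {W : Op n →ₗ[ℂ] S2 → ℂ} (hW : Function.Injective W)
    (hp : ∀ P, IsPolyOfDegreeLE n (W P)) {F : S2 → ℂ} (hF : IsPolyOfDegreeLE n F) :
    ∃ P, W P = F := by
  have h1 : LinearMap.range W ≤ Submodule.span ℂ (Set.range (polyFamily n)) := by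
    rintro _ ⟨P, rfl⟩
    exact (hp P).mem_span
  have h2 : Module.finrank ℂ (Submodule.span ℂ (Set.range (polyFamily n))) ≤
      Module.finrank ℂ (LinearMap.range W) := by
    rw [LinearMap.finrank_range_of_inj hW, Module.finrank_matrix]
    refine (finrank_range_le_card (R := ℂ) (polyFamily n)).trans ?_
    simp
  have : FiniteDimensional ℂ (Submodule.span ℂ (Set.range (polyFamily n))) :=
    FiniteDimensional.span_of_finite ℂ (Set.finite_range _)
  have h3 := hF.mem_span
  rwa [← Submodule.eq_of_le_of_finrank_le h1 h2] at h3

/-! ### Contravariant symbols -/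

theorem isContravariantSymbol_charKernel {n : ℕ} {c : Fin n → ℝ} (hc : ∀ l, c l ≠ 0) :
    IsContravariantSymbol n (charKernel n fun l => 1 / c l)
      (covariantSymbol n (charKernel n c)) :=
  ⟨isPolyOfDegreeLE_covariantSymbol (charKernel_isDiag n c), charKernel_reconstruction hc⟩

/-- Write `W P` as the covariant symbol of some `Q`; the integral in (1) then equals both `P` and
`Q`. -/
theorem eq_covariantSymbol_of_isContravariantSymbol {n : ℕ} {c : Fin n → ℝ} (hc : ∀ l, c l ≠ 0)
    {W : Op n → S2 → ℂ} (hW : IsContravariantSymbol n (charKernel n fun l => 1 / c l) W) :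
    W = covariantSymbol n (charKernel n c) := by
  ext1 P
  obtain ⟨Q, hQ⟩ := exists_symbol_eq
    (W := (isLinearMap_covariantSymbol n (charKernel n c)).mk' (covariantSymbol n (charKernel n c)))
    (isOperatorKernel_charKernel hc).2.injective
    (isPolyOfDegreeLE_covariantSymbol (charKernel_isDiag n c)) (hW.poly P)
  have hQ' : covariantSymbol n (charKernel n c) Q = W P := hQ
  have h := hW.integral_eq P
  rw [← hQ', ← charKernel_reconstruction hc Q] at h
  rw [← hQ', h]

/-! ### Stratonovich–Weyl correspondences -/

theorem IsSymbolCorrespondence.exists_covariantSymbol_eq {n : ℕ} {W : Op n → S2 → ℂ}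
    (hW : IsSymbolCorrespondence n W) : ∃ K : Op n, K.IsDiag ∧ covariantSymbol n K = W := by
  let K : Op n := Matrix.of fun r s => W (Matrix.single s r 1) northPole
  have hK : ∀ P : Op n, (P * K).trace = W P northPole := by
    intro P
    let w := hW.linear.mk' W
    have e : W P = ∑ r, ∑ s, P r s • W (Matrix.single r s 1) := by
      change w P = ∑ r, ∑ s, P r s • w (Matrix.single r s 1)
      conv_lhs => rw [Matrix.matrix_eq_sum_single P]
      simp only [map_sum]
      refine Finset.sum_congr rfl fun r _ => Finset.sum_congr rfl fun s _ => ?_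
      rw [← map_smul, Matrix.smul_single, smul_eq_mul, mul_one]
    rw [e, Matrix.trace]
    simp only [Finset.sum_apply, Pi.smul_apply, smul_eq_mul, Matrix.diag_apply, Matrix.mul_apply]
    rfl
  -- `torusElt` fixes the north pole but multiplies an off-diagonal matrix unit by a factor
  -- different from `1`, so the symbol of that unit vanishes there.
  have hd : K.IsDiag := by
    intro r s hrs
    have h1 := hW.equivariant torusElt (Matrix.single s r 1) northPole
    have h2 : actOp n torusElt (Matrix.single s r 1) = Complex.exp (Complex.I *
        (2 * (((r : ℕ) : ℤ) - ((s : ℕ) : ℤ) : ℤ))) • (Matrix.single s r 1 : Op n) := by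
      ext a b
      rw [actOp_torusElt, Matrix.smul_apply, smul_eq_mul, Matrix.single_apply]
      split_ifs with hab
      · rw [hab.1, hab.2]
      · simp
    rw [h2, hW.linear.map_smul, rotS_torusElt_inv, Pi.smul_apply, smul_eq_mul] at h1
    change W (Matrix.single s r 1) northPole = 0
    by_contra h0
    have h3 : Complex.exp (Complex.I * (2 * (((r : ℕ) : ℤ) - ((s : ℕ) : ℤ) : ℤ))) =
        Complex.exp (Complex.I * (2 * ((0 : ℤ) : ℤ))) := by
      apply mul_right_cancel₀ h0
      rw [h1]
      simp
    have h4 := exp_I_two_mul_int_injective h3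
    exact hrs (Fin.ext (by omega))
  refine ⟨K, hd, ?_⟩
  ext P x
  obtain ⟨g, rfl⟩ := exists_rotS_eq x
  have h := hW.equivariant g⁻¹ P northPole
  rw [inv_inv] at h
  rw [← h, ← hK, covariantSymbol, kernelAt_rotS n hd, trace_actOp_mul, inv_inv]

/-- Reality turns `conj(W_P)` into the symbol of `P*`, so the inner product of symbols is `trace(P*
∫ W_Q K dS)`; since `P` is arbitrary, the trace form detects the operator. -/
theorem isometry_iff_reconstruction {n : ℕ} {K : Op n} (hK : IsOperatorKernel n K) :
    (∀ P Q : Op n, 1 / (4 * (Real.pi : ℂ)) * ∫ x, (starRingEnd ℂ) (covariantSymbol n K P x) *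
        covariantSymbol n K Q x ∂surface = 1 / ((n : ℂ) + 1) * (P.conjTranspose * Q).trace) ↔
      ∀ Q, Q = (((n : ℂ) + 1) / (4 * (Real.pi : ℂ))) •
        kernelIntegral n K (covariantSymbol n K Q) := by
  have h4 : (n : ℂ) + 1 ≠ 0 := by exact_mod_cast Nat.succ_ne_zero n
  have h5 : (Real.pi : ℂ) ≠ 0 := by exact_mod_cast Real.pi_ne_zero
  have e : ∀ P Q : Op n, ∫ x, (starRingEnd ℂ) (covariantSymbol n K P x) *
      covariantSymbol n K Q x ∂surface =
        (P.conjTranspose * kernelIntegral n K (covariantSymbol n K Q)).trace := by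
    intro P Q
    rw [trace_mul_kernelIntegral hK.1 (isPolyOfDegreeLE_covariantSymbol hK.1 Q).continuous]
    refine integral_congr_ae (Filter.Eventually.of_forall fun x => ?_)
    simp only
    rw [hK.2.real, mul_comm]
  constructor
  · intro h Q
    refine Matrix.ext_iff_trace_mul_left.mpr fun P => ?_
    have h1 := h P.conjTranspose Q
    rw [e, Matrix.conjTranspose_conjTranspose] at h1
    rw [mul_smul_comm, Matrix.trace_smul, smul_eq_mul]
    field_simp at h1 ⊢
    linear_combination -h1
  · intro h P Q
    rw [e]
    conv_rhs => rw [h Q]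
    rw [mul_smul_comm, Matrix.trace_smul, smul_eq_mul]
    field_simp

theorem isStratonovichWeyl_iff_isSelfDual {n : ℕ} {W : Op n → S2 → ℂ}
    (hW : IsSymbolCorrespondence n W) : IsStratonovichWeyl n W ↔ IsSelfDual n W := by
  constructor
  · intro h
    obtain ⟨K, hd, rfl⟩ := hW.exists_covariantSymbol_eq
    exact ⟨K, ⟨hd, hW⟩, rfl, isPolyOfDegreeLE_covariantSymbol hd,
      (isometry_iff_reconstruction ⟨hd, hW⟩).mp h.isometry⟩
  · rintro ⟨K, hK, rfl, hc⟩
    exact ⟨hW, (isometry_iff_reconstruction hK).mpr hc.integral_eq⟩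

end SpinJ
end

open SpinJ
theorem theorem6p2p2 (n : ℕ) :
    (∀ c : Fin n → ℝ, (∀ l, c l ≠ 0) →
      IsOperatorKernel n (charKernel n c) ∧
      (∀ W : Op n → S2 → ℂ,
        IsContravariantSymbol n (charKernel n fun l => 1 / c l) W ↔
          W = covariantSymbol n (charKernel n c)) ∧
      (∀ c' : Fin n → ℝ, (∀ l, c' l ≠ 0) →
        (IsContravariantSymbol n (charKernel n c') (covariantSymbol n (charKernel n c)) ↔
          ∀ l, c' l = 1 / c l))) ∧
    (∀ W : Op n → S2 → ℂ, IsSymbolCorrespondence n W →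
      (IsStratonovichWeyl n W ↔ IsSelfDual n W)) := by
  refine ⟨fun c hc => ⟨isOperatorKernel_charKernel hc, fun W =>
    ⟨eq_covariantSymbol_of_isContravariantSymbol hc, ?_⟩, fun c' hc' => ⟨fun h l => ?_, fun h => ?_⟩⟩,
    fun W hW => isStratonovichWeyl_iff_isSelfDual hW⟩
  · rintro rfl
    exact isContravariantSymbol_charKernel hc
  -- Apply uniqueness to the numbers `1/c'`, whose inverses are `c'`: then `W^{K_c} = W^{K_{1/c'}}`,
  -- and a covariant symbol map determines its characteristic numbers.
  · have h1 : ∀ l, 1 / c' l ≠ 0 := fun l => one_div_ne_zero (hc' l)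
    have h2 : (fun l => 1 / (1 / c' l)) = c' := by ext l; rw [one_div_one_div]
    have h3 := eq_covariantSymbol_of_isContravariantSymbol (c := fun l => 1 / c' l) h1
      (by rwa [h2])
    have h4 := charKernel_injective (covariantSymbol_injective (charKernel_isDiag n _)
      (charKernel_isDiag n _) h3)
    rw [h4, one_div_one_div]
  · have h1 : c' = fun l => 1 / c l := funext h
    rw [h1]
    exact isContravariantSymbol_charKernel hc
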